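/- Let $\Omega\subset\mathbb R^3$ be a bounded domain with $C^\infty$ boundary, $\gamma>0$, $T>0$, $g\in L^2(\Omega)$, and let $f\in C^1(\mathbb R)$ satisfy $|f'(s)|\le C(1+|s|^4)$ for all $s\in\mathbb R$ and some constant $C$. Put $F(s)=\int_0^s f(r)\,dr$, let $(\cdot,\cdot)$ be the inner product of $L^2(\Omega)$, and let $\mathcal E=H^1_0(\Omega)\times L^2(\Omega)$ with $\|(u,v)\|_{\mathcal E}^2=\|\nabla u\|_{L^2}^2+\|v\|_{L^2}^2$ and $\xi_u=(u,\partial_t u)$. A *Shatah–Struwe solution* on $[0,T]$ of $$\partial_t^2u+\gamma\,\partial_tu-\Delta u+f(u)=g\ \text{ in }\Omega,\qquad u|_{\partial\Omega}=0,$$ is a function $u$ such that $\xi_u\in L^\infty(0,T;\mathcal E)$ (with $\partial_tu$ the distributional time derivative), $u\in L^4(0,T;L^{12}(\Omega))$, and the equation holds in the sense of distributions: $$-\int_0^T(\partial_tu,\partial_t\phi)\,dt-\gamma\int_0^T(u,\partial_t\phi)\,dt+\int_0^T(\nabla u,\nabla\phi)\,dt+\int_0^T(f(u),\phi)\,dt=\int_0^T(g,\phi)\,dt$$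 for all $\phi\in C_c^\infty((0,T)\times\Omega)$. Let $u$ be a Shatah–Struwe solution on $[0,T]$. Then, after modification on a set of times of measure zero, $\xi_u\in C([0,T];\mathcal E)$, and for this continuous representative: $F(u(t))\in L^1(\Omega)$ for every $t\in[0,T]$, the functions $t\mapsto\|\xi_u(t)\|_{\mathcal E}$ and $t\mapsto(F(u(t)),1)=\int_\Omega F(u(t,x))\,dx$ are absolutely continuous on $[0,T]$, and $$\frac{d}{dt}\Big(\tfrac12\|\xi_u(t)\|_{\mathcal E}^2+(F(u(t)),1)-(g,u(t))\Big)+\gamma\|\partial_tu(t)\|_{L^2}^2=0$$ for almost every $t\in[0,T]$. -/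

import Mathlib

open MeasureTheory Set Filter Topology
open scoped ContDiff

noncomputable section

namespace DampedWave

/-- The physical space `ℝ³` with its Euclidean norm. -/
abbrev Space : Type := EuclideanSpace ℝ (Fin 3)

/-- `Ω` is a bounded domain (open, connected, non-empty) with `C^∞` boundary: near each of its
boundary points, `Ω` is the sublevel set `{ρ < 0}` of a smooth function with non-zero differential
at that point. -/
structure IsSmoothBoundedDomain (Ω : Set Space) : Prop where
  isOpen : IsOpen Ω
  isConnected : IsConnected Ω
  isBounded : Bornology.IsBounded Ω
  smooth_boundary : ∀ x ∈ frontier Ω, ∃ (U : Set Space) (ρ : Space → ℝ),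
    IsOpen U ∧ x ∈ U ∧ ContDiffOn ℝ ∞ ρ U ∧ fderiv ℝ ρ x ≠ 0 ∧ Ω ∩ U = {y ∈ U | ρ y < 0}

/-- The space `L²(Ω)` of real functions. -/
abbrev L2 (Ω : Set Space) : Type := Lp ℝ 2 (volume.restrict Ω)

/-- The space `L²(Ω; ℝ³)` of vector fields. -/
abbrev L2Vec (Ω : Set Space) : Type := Lp Space 2 (volume.restrict Ω)

/-- `φ ∈ C_c^∞(D)`: smooth, with compact support contained in `D`. -/
structure IsTestFunction {E : Type*} [NormedAddCommGroup E] [NormedSpace ℝ E]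
    (D : Set E) (φ : E → ℝ) : Prop where
  contDiff : ContDiff ℝ ∞ φ
  hasCompactSupport : HasCompactSupport φ
  tsupport_subset : tsupport φ ⊆ D

/-- `H¹₀(Ω)`, realized as the closure of `{(φ, ∇φ) : φ ∈ C_c^∞(Ω)}` in the Hilbert space
`L²(Ω) × L²(Ω; ℝ³)`, that is, as the closure of `C_c^∞(Ω)` in the `H¹` norm
`(‖u‖² + ‖∇u‖²)^(1/2)`. (The set of pairs is already a linear subspace, so the span only packages
it as a submodule.) -/
def H10 (Ω : Set Space) : Submodule ℝ (WithLp 2 (L2 Ω × L2Vec Ω)) :=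
  (Submodule.span ℝ {w : WithLp 2 (L2 Ω × L2Vec Ω) | ∃ φ : Space → ℝ, IsTestFunction Ω φ ∧
    (w.fst : Space → ℝ) =ᵐ[volume.restrict Ω] φ ∧
    (w.snd : Space → Space) =ᵐ[volume.restrict Ω] gradient φ}).topologicalClosure

/-- The underlying `L²` function of an element of `H¹₀(Ω)`. -/
def valL2 {Ω : Set Space} (u : H10 Ω) : L2 Ω := (u : WithLp 2 (L2 Ω × L2Vec Ω)).fst

/-- The (weak) gradient of an element of `H¹₀(Ω)`. -/
def gradL2 {Ω : Set Space} (u : H10 Ω) : L2Vec Ω := (u : WithLp 2 (L2 Ω × L2Vec Ω)).snd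

/-- The partial derivative `∂ₜφ` of a function of `(t, x)`. -/
def timeDeriv (φ : ℝ × Space → ℝ) (t : ℝ) (x : Space) : ℝ := deriv (fun s => φ (s, x)) t

/-- The spatial gradient `∇ₓφ` of a function of `(t, x)`. -/
def spaceGrad (φ : ℝ × Space → ℝ) (t : ℝ) (x : Space) : Space := gradient (fun y => φ (t, y)) x

/-- `(u, ut)` is a weak (energy) solution on `[0, T]` of
`∂ₜ²u + γ ∂ₜu - Δu + f(u) = g` in `Ω`, `u = 0` on `∂Ω`:
the pair `ξ_u = (u, ut)` is in `L^∞(0, T; H¹₀(Ω) × L²(Ω))`, `ut` is the distributional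
time derivative of `u`, and the equation holds in the sense of distributions. -/
structure IsWeakSolution (Ω : Set Space) (T γ : ℝ) (f : ℝ → ℝ) (g : L2 Ω)
    (u : ℝ → H10 Ω) (ut : ℝ → L2 Ω) : Prop where
  memLp_u : MemLp u ⊤ (volume.restrict (Ioo 0 T))
  memLp_ut : MemLp ut ⊤ (volume.restrict (Ioo 0 T))
  time_deriv : ∀ φ : ℝ × Space → ℝ, IsTestFunction (Ioo 0 T ×ˢ Ω) φ →
    ∫ t in Ioo 0 T, ∫ x in Ω, valL2 (u t) x * timeDeriv φ t x =
      -∫ t in Ioo 0 T, ∫ x in Ω, ut t x * φ (t, x)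
  equation : ∀ φ : ℝ × Space → ℝ, IsTestFunction (Ioo 0 T ×ˢ Ω) φ →
    -(∫ t in Ioo 0 T, ∫ x in Ω, ut t x * timeDeriv φ t x)
      - γ * (∫ t in Ioo 0 T, ∫ x in Ω, valL2 (u t) x * timeDeriv φ t x)
      + (∫ t in Ioo 0 T, ∫ x in Ω, inner ℝ (gradL2 (u t) x) (spaceGrad φ t x))
      + (∫ t in Ioo 0 T, ∫ x in Ω, f (valL2 (u t) x) * φ (t, x))
    = ∫ t in Ioo 0 T, ∫ x in Ω, g x * φ (t, x)

/-- A Shatah–Struwe solution: a weak solution with `u ∈ L⁴(0, T; L¹²(Ω))`. -/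
structure IsShatahStruweSolution (Ω : Set Space) (T γ : ℝ) (f : ℝ → ℝ) (g : L2 Ω)
    (u : ℝ → H10 Ω) (ut : ℝ → L2 Ω) : Prop extends IsWeakSolution Ω T γ f g u ut where
  strichartz : ∫⁻ t in Ioo 0 T, eLpNorm (valL2 (u t)) 12 (volume.restrict Ω) ^ (4 : ℕ) < ⊤

/-- The energy norm `‖(u, v)‖ = (‖∇u‖² + ‖v‖²)^(1/2)` on `H¹₀(Ω) × L²(Ω)`. -/
def energyNorm {Ω : Set Space} (u : H10 Ω) (v : L2 Ω) : ℝ := Real.sqrt (‖gradL2 u‖ ^ 2 + ‖v‖ ^ 2)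

/-- The primitive `F(s) = ∫₀ˢ f`. -/
def primitive (f : ℝ → ℝ) (s : ℝ) : ℝ := ∫ r in (0 : ℝ)..s, f r

/-- The potential energy `(F(u), 1)`, the integral of `F(u)` over `Ω`. -/
def potentialEnergy {Ω : Set Space} (f : ℝ → ℝ) (u : H10 Ω) : ℝ :=
  ∫ x in Ω, primitive f (valL2 u x)

end DampedWave

end

/-! The growth of f' gives |f(s)| ≤ A(1 + |s|⁵), and Hölder with 1/2 = 1/6 + 1/3 bounds the L² norm
of 1 + |u|⁵ by |Ω|^(1/2) + ‖u‖_{L⁶} ‖u‖⁴_{L¹²}. The Sobolev embedding bounds the L⁶ factor uniformly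
in time and the Strichartz hypothesis makes the other one integrable. Hence f(u) ∈ L¹(0,T; L²), and
u solves a linear wave equation with forcing h = g - f(u) - γ∂ₜu in L¹(0,T; L²).

For the linear equation (`linear_wave`), let S be the inverse of the generator (u, v) ↦ (v, Δu - u),
a bounded skew-adjoint operator on H¹₀ × L². The equation ξ' = S⁻¹ξ + k becomes (Sξ)' = ξ + Sk, so
Sξ agrees a.e. with an absolutely continuous function, by du Bois-Reymond. The resolvents Rₙ = (εₙ -
S)⁻¹ commute with S, and -RₙS = 1 - εₙRₙ converges strongly to the identity on the closure of the
range of S. Thus -Rₙ(Sξ) are absolutely continuous approximations of ξ, and they satisfy an exact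
energy identity because ⟨Sx, x⟩ = 0. A Gronwall bound on their differences makes them uniformly
Cauchy, and `exists_continuous_representative` passes to the limit.

For the potential energy (`potentialEnergy_sub_eq_integral`), f is truncated to Lipschitz functions
fₙ. Then v ↦ ∫Fₙ(v) is Fréchet differentiable on L², and the chain rule applies along u, which is a
C¹ curve in L². Dominated convergence removes the truncation: |Fₙ(u)| ≤ 2A(1 + |u|⁶), and the bound
on ‖fₙ(u)‖ does not depend on n. When the two identities are added, the contributions of g and f(u)
cancel and only -γ∫‖∂ₜu‖² remains, with a continuous integrand. -/

noncomputable section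

namespace DampedWave

/-! ### Absolute continuity, du Bois-Reymond and a Gronwall bound. -/

section AbsoluteContinuity

variable {E F : Type*} [NormedAddCommGroup E] [NormedSpace ℝ E]
  [NormedAddCommGroup F] [NormedSpace ℝ F]

/-- A function whose increments are dominated by the integrals of an integrable function is
absolutely continuous. -/
theorem absolutelyContinuousOnInterval_of_dist_le_integral {X : Type*} [PseudoMetricSpace X]
    {f : ℝ → X} {κ : ℝ → ℝ} {a b : ℝ} (hab : a ≤ b) (hκ : IntervalIntegrable κ volume a b)
    (h : ∀ s ∈ Icc a b, ∀ t ∈ Icc a b, s ≤ t → dist (f s) (f t) ≤ ∫ r in s..t, κ r) :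
    AbsolutelyContinuousOnInterval f a b := by
  have hK := hκ.absolutelyContinuousOnInterval_intervalIntegral (c := a) (by simp)
  have key : ∀ s ∈ Icc a b, ∀ t ∈ Icc a b, s ≤ t →
      dist (f s) (f t) ≤ dist (∫ r in a..s, κ r) (∫ r in a..t, κ r) := by
    intro s hs t ht hst
    have h1 : IntervalIntegrable κ volume a s :=
      hκ.mono_set (by rw [uIcc_of_le hs.1, uIcc_of_le hab]; exact Icc_subset_Icc_right hs.2)
    have h2 : IntervalIntegrable κ volume a t :=
      hκ.mono_set (by rw [uIcc_of_le ht.1, uIcc_of_le hab]; exact Icc_subset_Icc_right ht.2)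
    rw [dist_comm (∫ r in a..s, κ r), Real.dist_eq,
      intervalIntegral.integral_interval_sub_left h2 h1]
    exact (h s hs t ht hst).trans (le_abs_self _)
  have key' : ∀ s ∈ Icc a b, ∀ t ∈ Icc a b,
      dist (f s) (f t) ≤ dist (∫ r in a..s, κ r) (∫ r in a..t, κ r) := by
    intro s hs t ht
    rcases le_total s t with hst | hst
    · exact key s hs t ht hst
    · rw [dist_comm (f s), dist_comm (∫ r in a..s, κ r)]
      exact key t ht s hs hst
  rw [absolutelyContinuousOnInterval_iff] at hK ⊢
  intro ε hε
  obtain ⟨δ, hδ, H⟩ := hK ε hε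
  refine ⟨δ, hδ, fun I hI hlen => lt_of_le_of_lt (Finset.sum_le_sum fun i hi => ?_) (H I hI hlen)⟩
  have := hI.1 i hi
  rw [uIcc_of_le hab] at this
  exact key' _ this.1 _ this.2

theorem intervalIntegrable_of_subset {E : Type*} [NormedAddCommGroup E] {m : ℝ → E} {a b s t : ℝ}
    (hm : IntervalIntegrable m volume a b) (hab : a ≤ b) (hs : s ∈ Icc a b) (ht : t ∈ Icc a b) :
    IntervalIntegrable m volume s t :=
  hm.mono_set (by rw [uIcc_of_le hab]; exact uIcc_subset_Icc hs ht)

/-- The primitive of an integrable vector valued function is absolutely continuous. -/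
theorem absolutelyContinuousOnInterval_primitive {m : ℝ → E} {a b : ℝ} (hab : a ≤ b)
    (hm : IntervalIntegrable m volume a b) (c : E) :
    AbsolutelyContinuousOnInterval (fun t => c + ∫ r in a..t, m r) a b := by
  refine absolutelyContinuousOnInterval_of_dist_le_integral hab hm.norm fun s hs t ht hst => ?_
  have ha : a ∈ Icc a b := left_mem_Icc.2 hab
  rw [dist_comm, dist_eq_norm, add_sub_add_left_eq_sub,
    intervalIntegral.integral_interval_sub_left (intervalIntegrable_of_subset hm hab ha ht)
      (intervalIntegrable_of_subset hm hab ha hs)]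
  exact intervalIntegral.norm_integral_le_integral_norm hst

theorem ae_hasDerivAt_primitive [CompleteSpace E] {m : ℝ → E} {a b : ℝ}
    (hm : IntervalIntegrable m volume a b) (c : E) :
    ∀ᵐ t, t ∈ uIcc a b → HasDerivAt (fun t => c + ∫ r in a..t, m r) (m t) t := by
  filter_upwards [hm.ae_hasDerivAt_integral] with t ht htab
  exact (ht htab a left_mem_uIcc).const_add c

/-- The fundamental theorem of calculus for vector valued absolutely continuous functions. -/
theorem _root_.AbsolutelyContinuousOnInterval.sub_eq_integral [CompleteSpace E] {f m : ℝ → E}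
    {a b : ℝ} (hab : a ≤ b) (hf : AbsolutelyContinuousOnInterval f a b)
    (hm : IntervalIntegrable m volume a b)
    (hd : ∀ᵐ t, t ∈ uIcc a b → HasDerivAt f (m t) t) {s t : ℝ} (hs : s ∈ Icc a b)
    (ht : t ∈ Icc a b) : f t - f s = ∫ r in s..t, m r := by
  -- The difference with the primitive of `m` is absolutely continuous with derivative zero a.e.,
  -- hence constant.
  have hac := hf.fun_sub (absolutelyContinuousOnInterval_primitive hab hm 0)
  have h0 : ∀ᵐ t, t ∈ uIcc a b →
      HasDerivAt (fun t => f t - (0 + ∫ r in a..t, m r)) 0 t := by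
    filter_upwards [hd, ae_hasDerivAt_primitive hm (0 : E)] with t h1 h2 h
    simpa using (h1 h).fun_sub (h2 h)
  obtain ⟨C, hC⟩ := hac.const_of_ae_hasDerivAt_zero h0
  rw [uIcc_of_le hab] at hC
  have ha : a ∈ Icc a b := left_mem_Icc.2 hab
  have e1 := hC s hs
  have e2 := hC t ht
  rw [← intervalIntegral.integral_interval_sub_left (intervalIntegrable_of_subset hm hab ha ht)
      (intervalIntegrable_of_subset hm hab ha hs)]
  rw [← e1] at e2
  simp only [zero_add] at e2
  have := sub_eq_zero.2 e2
  rw [← sub_eq_zero, ← this]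
  abel

/-- The composition of an absolutely continuous function with a Lipschitz one is absolutely
continuous. -/
theorem _root_.AbsolutelyContinuousOnInterval.lipschitz_comp {X Y : Type*} [PseudoMetricSpace X]
    [PseudoMetricSpace Y] {f : ℝ → X} {a b : ℝ} (hf : AbsolutelyContinuousOnInterval f a b)
    {φ : X → Y} {K : ℝ} (hK : 0 ≤ K)
    (hφ : ∀ s ∈ uIcc a b, ∀ t ∈ uIcc a b, dist (φ (f s)) (φ (f t)) ≤ K * dist (f s) (f t)) :
    AbsolutelyContinuousOnInterval (fun t => φ (f t)) a b := by
  rw [absolutelyContinuousOnInterval_iff] at hf ⊢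
  intro ε hε
  -- `K + 1` because `K` may be zero.
  obtain ⟨δ, hδ, H⟩ := hf (ε / (K + 1)) (by positivity)
  refine ⟨δ, hδ, fun I hI hlen => ?_⟩
  have h1 := H I hI hlen
  calc ∑ i ∈ Finset.range I.1, dist (φ (f (I.2 i).1)) (φ (f (I.2 i).2))
      ≤ ∑ i ∈ Finset.range I.1, (K + 1) * dist (f (I.2 i).1) (f (I.2 i).2) := by
        refine Finset.sum_le_sum fun i hi => (hφ _ (hI.1 i hi).1 _ (hI.1 i hi).2).trans ?_
        gcongr
        linarith
    _ = (K + 1) * ∑ i ∈ Finset.range I.1, dist (f (I.2 i).1) (f (I.2 i).2) := by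
        rw [Finset.mul_sum]
    _ < (K + 1) * (ε / (K + 1)) := by gcongr
    _ = ε := by field_simp

/-- This leaves room at both ends, so that a primitive vanishing outside `Icc c d` still has its
support inside `Ioo a b`. -/
theorem exists_Ioo_of_isCompact {K : Set ℝ} (hK : IsCompact K) {a b : ℝ} (hab : a < b)
    (hKab : K ⊆ Ioo a b) : ∃ c d, a < c ∧ c < d ∧ d < b ∧ K ⊆ Ioo c d := by
  rcases K.eq_empty_or_nonempty with rfl | hne
  · exact ⟨(2 * a + b) / 3, (a + 2 * b) / 3, by linarith, by linarith, by linarith, by simp⟩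
  · have h1 := hKab (hK.sInf_mem hne)
    have h2 := hKab (hK.sSup_mem hne)
    have h3 : sInf K ≤ sSup K := Real.sInf_le_sSup K hK.bddBelow hK.bddAbove
    refine ⟨(a + sInf K) / 2, (b + sSup K) / 2, by linarith [h1.1], by linarith [h1.1, h2.2],
      by linarith [h2.2], fun x hx => ⟨?_, ?_⟩⟩
    · have := csInf_le hK.bddBelow hx
      linarith [h1.1]
    · have := le_csSup hK.bddAbove hx
      linarith [h2.2]

theorem IsTestFunction.add {D : Set E} {φ ψ : E → ℝ} (hφ : IsTestFunction D φ)
    (hψ : IsTestFunction D ψ) : IsTestFunction D (φ + ψ) where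
  contDiff := hφ.contDiff.add hψ.contDiff
  hasCompactSupport := hφ.hasCompactSupport.add hψ.hasCompactSupport
  tsupport_subset := (tsupport_add φ ψ).trans
    (union_subset hφ.tsupport_subset hψ.tsupport_subset)

theorem IsTestFunction.const_smul {D : Set E} {φ : E → ℝ} (c : ℝ) (hφ : IsTestFunction D φ) :
    IsTestFunction D (c • φ) where
  contDiff := contDiff_const.smul hφ.contDiff
  hasCompactSupport := hφ.hasCompactSupport.smul_left (f := fun _ => c)
  tsupport_subset := (tsupport_smul_subset_right (fun _ => c) φ).trans hφ.tsupport_subset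

/-- A test function on an interval with vanishing mean has a primitive which is a test function. -/
theorem IsTestFunction.exists_deriv_eq {a b : ℝ} (hab : a < b) {ψ : ℝ → ℝ}
    (hψ : IsTestFunction (Ioo a b) ψ) (h0 : ∫ t, ψ t = 0) :
    ∃ θ, IsTestFunction (Ioo a b) θ ∧ deriv θ = ψ := by
  obtain ⟨c, d, hac, hcd, hdb, hK⟩ :=
    exists_Ioo_of_isCompact hψ.hasCompactSupport hab hψ.tsupport_subset
  have hzero : ∀ x, x ∉ Ioo c d → ψ x = 0 := fun x hx =>
    image_eq_zero_of_notMem_tsupport fun h => hx (hK h)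
  have hcont := hψ.contDiff.continuous
  have hder : ∀ t, HasDerivAt (fun t => ∫ s in c..t, ψ s) (ψ t) t := fun t =>
    intervalIntegral.integral_hasDerivAt_right (hcont.intervalIntegrable _ _)
      (hcont.stronglyMeasurableAtFilter _ _) hcont.continuousAt
  have hd : deriv (fun t => ∫ s in c..t, ψ s) = ψ := funext fun t => (hder t).deriv
  have hI : ∫ s in c..d, ψ s = 0 := by
    rw [intervalIntegral.integral_of_le hcd.le, setIntegral_eq_integral_of_forall_compl_eq_zero, h0]
    intro x hx
    exact hzero x fun h => hx (Ioo_subset_Ioc_self h)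
  -- Left of `c` the integrand vanishes; right of `d` the integral is the full one, which is zero.
  have hsupp : Function.support (fun t => ∫ s in c..t, ψ s) ⊆ Icc c d := by
    intro t ht
    by_contra hn
    apply ht
    rw [mem_Icc, not_and_or, not_le, not_le] at hn
    rcases hn with hn | hn
    · refine intervalIntegral.integral_zero_ae (Eventually.of_forall fun x hx => hzero x fun h => ?_)
      rw [uIoc_of_ge hn.le] at hx
      exact absurd h.1 (not_lt.2 hx.2)
    · show ∫ s in c..t, ψ s = 0
      rw [← intervalIntegral.integral_add_adjacent_intervals (hcont.intervalIntegrable c d)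
        (hcont.intervalIntegrable d t), hI, zero_add]
      refine intervalIntegral.integral_zero_ae (Eventually.of_forall fun x hx => hzero x fun h => ?_)
      rw [uIoc_of_le hn.le] at hx
      exact absurd h.2 (not_lt.2 hx.1.le)
  refine ⟨fun t => ∫ s in c..t, ψ s, ⟨?_, ?_, ?_⟩, hd⟩
  · rw [contDiff_infty_iff_deriv, hd]
    exact ⟨fun t => (hder t).differentiableAt, hψ.contDiff⟩
  · exact HasCompactSupport.of_support_subset_isCompact isCompact_Icc hsupp
  · exact (closure_minimal hsupp isClosed_Icc).trans (Icc_subset_Ioo hac hdb)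

theorem exists_isTestFunction_integral_eq_one {a b : ℝ} (hab : a < b) :
    ∃ χ : ℝ → ℝ, IsTestFunction (Ioo a b) χ ∧ ∫ t, χ t = 1 := by
  let B : ContDiffBump ((a + b) / 2) := ⟨(b - a) / 8, (b - a) / 4, by linarith, by linarith⟩
  refine ⟨B.normed volume, ⟨B.contDiff_normed, B.hasCompactSupport_normed, ?_⟩, B.integral_normed⟩
  rw [B.tsupport_normed_eq, Real.closedBall_eq_Icc]
  exact Icc_subset_Ioo (by simp only [B]; linarith) (by simp only [B]; linarith)

theorem integrableOn_smul_of_hasCompactSupport {s : Set ℝ} {θ : ℝ → ℝ} {z : ℝ → E}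
    (hθ : Continuous θ) (hθc : HasCompactSupport θ) (hz : IntegrableOn z s) :
    IntegrableOn (fun t => θ t • z t) s := by
  obtain ⟨C, hC⟩ := hθc.exists_bound_of_continuous hθ
  exact hz.bdd_smul C hθ.aestronglyMeasurable (Eventually.of_forall hC)

/-- **Du Bois-Reymond lemma** for vector valued functions. -/
theorem ae_eq_const_of_integral_deriv_smul_eq_zero [CompleteSpace E] {a b : ℝ} (hab : a < b)
    {z : ℝ → E} (hz : IntegrableOn z (Ioo a b))
    (h : ∀ θ, IsTestFunction (Ioo a b) θ → ∫ t in Ioo a b, deriv θ t • z t = 0) :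
    ∃ c, ∀ᵐ t ∂volume.restrict (Ioo a b), z t = c := by
  obtain ⟨χ, hχ, hχ1⟩ := exists_isTestFunction_integral_eq_one hab
  refine ⟨∫ t in Ioo a b, χ t • z t, ?_⟩
  set c := ∫ t in Ioo a b, χ t • z t
  have hc : IntegrableOn (fun _ : ℝ => c) (Ioo a b) := by simp
  have key : ∀ᵐ t, t ∈ Ioo a b → z t - c = 0 := by
    refine isOpen_Ioo.ae_eq_zero_of_integral_contDiff_smul_eq_zero
      (hz.sub hc).locallyIntegrableOn fun g hg1 hg2 hg3 => ?_
    have hg : IsTestFunction (Ioo a b) g := ⟨hg1, hg2, hg3⟩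
    have hgi := hg1.continuous.integrable_of_hasCompactSupport (μ := volume) hg2
    have hχi := hχ.contDiff.continuous.integrable_of_hasCompactSupport (μ := volume)
      hχ.hasCompactSupport
    -- Subtracting (∫g)χ makes the mean zero, so the result is the derivative of a test function.
    have hsub := hg.add (hχ.const_smul (-∫ t, g t))
    obtain ⟨θ, hθ, hd⟩ := hsub.exists_deriv_eq hab (by
      simp only [Pi.add_apply, Pi.smul_apply, smul_eq_mul]
      rw [integral_add hgi (hχi.const_mul _), integral_const_mul, hχ1]
      ring)
    have h1 := h θ hθ
    rw [hd] at h1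
    have e0 : ∫ x, g x • (z x - c) = ∫ x in Ioo a b, g x • (z x - c) := by
      rw [setIntegral_eq_integral_of_forall_compl_eq_zero]
      intro x hx
      rw [image_eq_zero_of_notMem_tsupport fun h' => hx (hg3 h'), zero_smul]
    have i1 := integrableOn_smul_of_hasCompactSupport hg1.continuous hg2 hz
    have i2 := integrableOn_smul_of_hasCompactSupport hχ.contDiff.continuous hχ.hasCompactSupport hz
    have i3 := integrableOn_smul_of_hasCompactSupport hg1.continuous hg2 hc
    have e1 : ∫ x in Ioo a b, g x • c = (∫ t, g t) • c := by
      rw [integral_smul_const, setIntegral_eq_integral_of_forall_compl_eq_zero]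
      intro x hx
      exact image_eq_zero_of_notMem_tsupport fun h' => hx (hg3 h')
    have e2 : ∫ t in Ioo a b, (g + (-∫ t, g t) • χ) t • z t =
        (∫ t in Ioo a b, g t • z t) + (-∫ t, g t) • c := by
      simp only [Pi.add_apply, Pi.smul_apply, add_smul, smul_assoc]
      rw [integral_add i1 (by exact i2.smul (-∫ t, g t)), integral_smul]
    rw [e0]
    simp only [smul_sub]
    rw [integral_sub i1 i3, e1]
    rw [e2] at h1
    rw [← h1]
    module
  rw [ae_restrict_iff' measurableSet_Ioo]
  filter_upwards [key] with t ht hts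
  exact sub_eq_zero.1 (ht hts)

/-- A function whose distributional derivative is integrable agrees a.e. with a primitive. -/
theorem exists_ae_eq_primitive [CompleteSpace E] {a b : ℝ} (hab : a < b) {z m : ℝ → E}
    (hz : IntegrableOn z (Ioo a b)) (hm : IntegrableOn m (Ioo a b))
    (h : ∀ θ, IsTestFunction (Ioo a b) θ →
      ∫ t in Ioo a b, deriv θ t • z t = -∫ t in Ioo a b, θ t • m t) :
    ∃ c, ∀ᵐ t ∂volume.restrict (Ioo a b), z t = c + ∫ r in a..t, m r := by
  have hmi : IntervalIntegrable m volume a b :=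
    (intervalIntegrable_iff_integrableOn_Ioo_of_le hab.le).2 hm
  have hac := absolutelyContinuousOnInterval_primitive hab.le hmi (0 : E)
  have hZ : IntegrableOn (fun t => 0 + ∫ r in a..t, m r) (Ioo a b) := by
    have := hac.continuousOn.integrableOn_compact (μ := volume) isCompact_uIcc
    rw [uIcc_of_le hab.le] at this
    exact this.mono_set Ioo_subset_Icc_self
  obtain ⟨c, hc⟩ := ae_eq_const_of_integral_deriv_smul_eq_zero hab (hz.sub hZ) (by
    intro θ hθ
    have hθ' : Continuous (deriv θ) := hθ.contDiff.continuous_deriv (by simp)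
    have hθ'c := hθ.hasCompactSupport.deriv
    have i1 := integrableOn_smul_of_hasCompactSupport hθ' hθ'c hz
    have i2 := integrableOn_smul_of_hasCompactSupport hθ' hθ'c hZ
    have i3 := integrableOn_smul_of_hasCompactSupport hθ.contDiff.continuous hθ.hasCompactSupport hm
    have hθac : AbsolutelyContinuousOnInterval θ a b :=
      ((hθ.contDiff.of_le (by simp)).contDiffOn).absolutelyContinuousOnInterval
    have hend : ∀ x, x ∉ Ioo a b → θ x = 0 := fun x hx =>
      image_eq_zero_of_notMem_tsupport fun h => hx (hθ.tsupport_subset h)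
    -- Integration by parts against the primitive of `m`; the boundary terms vanish with `θ`.
    have hp := (hθac.fun_smul hac).sub_eq_integral hab.le
      (m := fun t => θ t • m t + deriv θ t • (0 + ∫ r in a..t, m r))
      ((intervalIntegrable_iff_integrableOn_Ioo_of_le hab.le).2 (i3.add i2)) (by
        filter_upwards [ae_hasDerivAt_primitive hmi (0 : E)] with t h1 h2
        exact ((hθ.contDiff.differentiable (by simp)) t).hasDerivAt.smul (h1 h2))
      (left_mem_Icc.2 hab.le) (right_mem_Icc.2 hab.le)
    rw [hend a (by simp), hend b (by simp), zero_smul, zero_smul, sub_zero, intervalIntegral.integral_of_le hab.le,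
      integral_Ioc_eq_integral_Ioo, integral_add i3 i2] at hp
    simp only [Pi.sub_apply, smul_sub]
    rw [integral_sub i1 i2, h θ hθ]
    rw [sub_eq_zero]
    exact neg_eq_of_add_eq_zero_right hp.symm)
  refine ⟨c, hc.mono fun t ht => ?_⟩
  rw [← ht]
  simp

/-- A Gronwall type bound: if `e²` grows at most by `2 ∫ κ e`, then `e` grows at most by
`2 ∫ κ`. -/
theorem le_add_two_mul_integral {e κ : ℝ → ℝ} {a b : ℝ} (hab : a ≤ b)
    (he : ContinuousOn e (Icc a b)) (he0 : ∀ t, 0 ≤ e t) (hκ0 : ∀ t, 0 ≤ κ t)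
    (hκ : IntervalIntegrable κ volume a b)
    (h : ∀ s ∈ Icc a b, ∀ t ∈ Icc a b, e t ^ 2 ≤ e s ^ 2 + |2 * ∫ r in s..t, κ r * e r|)
    {s t : ℝ} (hs : s ∈ Icc a b) (ht : t ∈ Icc a b) :
    e t ≤ e s + 2 * ∫ r in a..b, κ r := by
  -- At a maximum point the hypothesis gives e(τ)² ≤ e(s)² + 2K e(τ) with K = ∫κ, which forces e(τ)
  -- ≤ e(s) + 2K.
  obtain ⟨τ, hτ, hmax⟩ := isCompact_Icc.exists_isMaxOn ⟨a, left_mem_Icc.2 hab⟩ he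
  have hK0 : 0 ≤ ∫ r in a..b, κ r := intervalIntegral.integral_nonneg hab fun r _ => hκ0 r
  have hi : |∫ r in s..τ, κ r * e r| ≤ (∫ r in a..b, κ r) * e τ := by
    calc |∫ r in s..τ, κ r * e r| ≤ ∫ r in uIoc s τ, ‖κ r * e r‖ := by
          rw [← Real.norm_eq_abs]
          exact intervalIntegral.norm_integral_le_integral_norm_uIoc
      _ ≤ ∫ r in uIoc s τ, κ r * e τ := by
          have hsub : uIoc s τ ⊆ Icc a b := uIoc_subset_uIcc.trans (uIcc_subset_Icc hs hτ)
          have hint : IntegrableOn (fun r => κ r * e τ) (uIoc s τ) :=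
            ((intervalIntegrable_of_subset hκ hab hs hτ).def').mul_const _
          refine setIntegral_mono_on₀ ?_ hint measurableSet_uIoc.nullMeasurableSet ?_
          · refine hint.mono' ?_ ?_
            · exact ((intervalIntegrable_of_subset hκ hab hs hτ).def'.aestronglyMeasurable.mul
                ((he.mono hsub).aestronglyMeasurable measurableSet_uIoc)).norm
            · refine (ae_restrict_iff' measurableSet_uIoc).2 (Eventually.of_forall fun r hr => ?_)
              rw [norm_norm, Real.norm_of_nonneg (mul_nonneg (hκ0 r) (he0 r))]
              exact mul_le_mul_of_nonneg_left (hmax (hsub hr)) (hκ0 r)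
          · intro r hr
            rw [Real.norm_of_nonneg (mul_nonneg (hκ0 r) (he0 r))]
            exact mul_le_mul_of_nonneg_left (hmax (hsub hr)) (hκ0 r)
      _ = (∫ r in uIoc s τ, κ r) * e τ := integral_mul_const _ _
      _ ≤ (∫ r in a..b, κ r) * e τ := by
          refine mul_le_mul_of_nonneg_right ?_ (he0 τ)
          rw [intervalIntegral.integral_of_le hab]
          refine setIntegral_mono_set hκ.1 (Eventually.of_forall hκ0) ?_
          exact LE.le.eventuallyLE
            (Ioc_subset_Ioc (le_min hs.1 hτ.1) (max_le hs.2 hτ.2))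
  have h1 := h s hs τ hτ
  rw [abs_mul, abs_two] at h1
  have h2 : e t ≤ e τ := hmax ht
  have h3 := he0 s
  have h4 := he0 τ
  set K := ∫ r in a..b, κ r
  have h5 : e τ ≤ e s + 2 * K := by
    by_contra hc
    push Not at hc
    nlinarith
  linarith

end AbsoluteContinuity

/-! ### Evolution equations governed by a bounded skew-adjoint operator. -/

section SkewEvolution

variable {E : Type*} [NormedAddCommGroup E] [InnerProductSpace ℝ E]

theorem inner_skew {S : E →L[ℝ] E} (hS : ∀ x, inner ℝ (S x) x = 0) (x y : E) :
    inner ℝ (S x) y = -inner ℝ x (S y) := by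
  have h := hS (x + y)
  rw [map_add, inner_add_left, inner_add_right, inner_add_right, hS x, hS y] at h
  rw [real_inner_comm (S y) x]
  linarith

/-- The resolvent of a bounded skew-adjoint operator. -/
theorem exists_resolvent_of_skew [CompleteSpace E] {S : E →L[ℝ] E}
    (hS : ∀ x, inner ℝ (S x) x = 0) {ε : ℝ} (hε : 0 < ε) :
    ∃ R : E →L[ℝ] E, (∀ x, ε • R x - S (R x) = x) ∧ (∀ x, R (S x) = S (R x)) ∧
      (∀ x, ‖ε • R x‖ ≤ ‖x‖) ∧ ∀ x, ‖S (R x)‖ ≤ ‖x‖ := by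
  let A : E →L[ℝ] E := ε • ContinuousLinearMap.id ℝ E - S
  have hA : ∀ x, A x = ε • x - S x := fun x => rfl
  -- Lax–Milgram: skewness makes the form of ε - S coercive with constant ε.
  let B : E →L[ℝ] E →L[ℝ] ℝ := (innerSL ℝ).comp A
  have hB : ∀ x y, B x y = inner ℝ (A x) y := fun x y => rfl
  have hco : IsCoercive B := by
    refine ⟨ε, hε, fun x => ?_⟩
    rw [hB, hA, inner_sub_left, hS, sub_zero, real_inner_smul_left, real_inner_self_eq_norm_mul_norm,
      mul_assoc]
  let e := hco.continuousLinearEquivOfBilin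
  have he : ∀ x, e x = A x := fun x =>
    ext_inner_right ℝ fun y => by rw [hco.continuousLinearEquivOfBilin_apply, hB]
  have h1 : ∀ x, ε • e.symm x - S (e.symm x) = x := fun x => by
    rw [← hA, ← he, e.apply_symm_apply]
  -- Pythagoras: εRx and SRx are orthogonal and differ by x. Both contraction bounds follow,
  -- uniformly in ε.
  have h2 : ∀ x, ‖ε • e.symm x‖ ^ 2 + ‖S (e.symm x)‖ ^ 2 = ‖x‖ ^ 2 := fun x => by
    conv_rhs => rw [← h1 x]
    rw [@norm_sub_sq_real, real_inner_smul_left, real_inner_comm, hS]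
    ring
  refine ⟨e.symm, h1, fun x => ?_, fun x => ?_, fun x => ?_⟩
  · show e.symm (S x) = S (e.symm x)
    apply e.injective
    rw [e.apply_symm_apply, he, hA, ← map_smul, ← map_sub, h1]
  · exact le_of_sq_le_sq ((le_add_of_nonneg_right (sq_nonneg _)).trans (h2 x).le) (norm_nonneg _)
  · exact le_of_sq_le_sq ((le_add_of_nonneg_left (sq_nonneg _)).trans (h2 x).le) (norm_nonneg _)

/-- Since S* = -S, the orthogonal complement of the range is the kernel. -/
theorem mem_closure_range_of_skew [CompleteSpace E] {S : E →L[ℝ] E}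
    (hS : ∀ x, inner ℝ (S x) x = 0) {x : E} (hx : ∀ n, S n = 0 → inner ℝ n x = 0) :
    x ∈ closure (range S) := by
  have h : x ∈ (S.toLinearMap.range)ᗮᗮ := by
    rw [Submodule.mem_orthogonal]
    intro n hn
    apply hx
    rw [Submodule.mem_orthogonal] at hn
    apply ext_inner_right ℝ
    intro y
    have h1 : inner ℝ (S y) n = 0 := hn _ ⟨y, rfl⟩
    rw [inner_skew hS, real_inner_comm, h1, inner_zero_left, neg_zero]
  rw [Submodule.orthogonal_orthogonal_eq_closure] at h
  rw [← SetLike.mem_coe, Submodule.topologicalClosure_coe] at h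
  exact h

/-- A bounded operator commuting with the skew operator `S` turns a solution of
`(S ξ)' = ξ + S k` into an absolutely continuous function satisfying the energy identity. -/
theorem energy_identity_of_commute [CompleteSpace E] {S M : E →L[ℝ] E}
    (hS : ∀ x, inner ℝ (S x) x = 0) (hM : ∀ x, M (S x) = S (M x)) {a b : ℝ} (hab : a ≤ b)
    {ξ k : ℝ → E} {c : E} (hξ : IntegrableOn ξ (Ioo a b)) (hk : IntegrableOn k (Ioo a b))
    (h : ∀ᵐ t ∂volume.restrict (Ioo a b), S (ξ t) = c + ∫ r in a..t, (ξ r + S (k r)))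
    {η : ℝ → E} (hη : ∀ t, η t = M (c + ∫ r in a..t, (ξ r + S (k r)))) :
    AbsolutelyContinuousOnInterval η a b ∧
    (∀ᵐ t ∂volume.restrict (Ioo a b), η t = M (S (ξ t))) ∧
    ∀ s ∈ Icc a b, ∀ t ∈ Icc a b,
      ‖η t‖ ^ 2 - ‖η s‖ ^ 2 = 2 * ∫ r in s..t, inner ℝ (M (S (k r))) (η r) := by
  have hm : IntervalIntegrable (fun r => ξ r + S (k r)) volume a b :=
    (intervalIntegrable_iff_integrableOn_Ioo_of_le hab).2 (hξ.add (S.integrable_comp hk))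
  have hMk : IntervalIntegrable (fun r => M (S (k r))) volume a b :=
    (intervalIntegrable_iff_integrableOn_Ioo_of_le hab).2
      (M.integrable_comp (S.integrable_comp hk))
  have hac0 := absolutelyContinuousOnInterval_primitive hab hm c
  have hac : AbsolutelyContinuousOnInterval η a b := by
    have := hac0.lipschitz_comp (φ := M) (norm_nonneg M) (fun s _ t _ => by
      rw [dist_eq_norm, dist_eq_norm, ← map_sub]
      exact M.le_opNorm _)
    simpa only [← hη] using this
  have hae : ∀ᵐ t ∂volume.restrict (Ioo a b), η t = M (S (ξ t)) := by
    filter_upwards [h] with t ht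
    rw [hη, ht]
  refine ⟨hac, hae, fun s hs t ht => ?_⟩
  -- The squared norm is Lipschitz only on bounded sets, so a bound of η is needed first.
  obtain ⟨B, hB⟩ := hac.exists_bound
  have hsq : AbsolutelyContinuousOnInterval (fun t => ‖η t‖ ^ 2) a b := by
    refine hac.lipschitz_comp (φ := fun x : E => ‖x‖ ^ 2) (K := 2 * |B|) (by positivity)
      fun s hs t ht => ?_
    have e : ‖η s‖ ^ 2 - ‖η t‖ ^ 2 = (‖η s‖ + ‖η t‖) * (‖η s‖ - ‖η t‖) := by ring
    rw [Real.dist_eq, dist_eq_norm, e, abs_mul]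
    gcongr
    · rw [abs_of_nonneg (by positivity)]
      linarith [hB s hs, hB t ht, le_abs_self B]
    · exact abs_norm_sub_norm_le _ _
  have hae' : ∀ᵐ t, t ∈ Ioo a b → η t = M (S (ξ t)) :=
    (ae_restrict_iff' measurableSet_Ioo).1 hae
  have hcont : ContinuousOn η (uIcc a b) := hac.continuousOn
  have hint : IntervalIntegrable (fun r => inner ℝ (M (S (k r))) (η r)) volume a b := by
    refine (hMk.norm.mul_continuousOn hcont.norm).mono_fun ?_ ?_
    · exact hMk.def'.aestronglyMeasurable.inner
        ((hcont.mono uIoc_subset_uIcc).aestronglyMeasurable measurableSet_uIoc)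
    · refine Eventually.of_forall fun r => ?_
      simp only [norm_mul, norm_norm]
      exact norm_inner_le_norm _ _
  have hend : ∀ᵐ t : ℝ, t ≠ a ∧ t ≠ b := by
    have h1 : ∀ᵐ x : ℝ, x ≠ a := by simp [ae_iff, measure_singleton]
    have h2 : ∀ᵐ x : ℝ, x ≠ b := by simp [ae_iff, measure_singleton]
    exact h1.and h2
  have := hsq.sub_eq_integral hab (hint.const_mul 2) (by
    filter_upwards [ae_hasDerivAt_primitive hm c, hae', hend] with t h1 h2 h3 h4
    have h5 : HasDerivAt η (M (ξ t + S (k t))) t := by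
      have := M.hasFDerivAt.comp_hasDerivAt t (h1 h4)
      rwa [show (M ∘ fun t => c + ∫ r in a..t, (ξ r + S (k r))) = η from
        funext fun t => (hη t).symm] at this
    have h6 := h5.norm_sq
    have h7 : t ∈ Ioo a b := by
      rw [uIcc_of_le hab] at h4
      exact ⟨lt_of_le_of_ne h4.1 (Ne.symm h3.1), lt_of_le_of_ne h4.2 h3.2⟩
    convert! h6 using 1
    -- Here η = MSξ = S(Mξ) is orthogonal to Mξ: the generator contributes nothing to the energy.
    have h8 : inner ℝ (η t) (M (ξ t)) = 0 := by rw [h2 h7, hM, hS]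
    rw [map_add, inner_add_right, h8, zero_add, real_inner_comm]) hs ht
  rw [this, intervalIntegral.integral_const_mul]

/-- Cauchy–Schwarz reduces this to the Gronwall bound. Applied to the difference of two
regularizations, it yields the uniform Cauchy property. -/
theorem norm_le_add_of_energy_identity {η κ : ℝ → E} {a b : ℝ} (hab : a ≤ b)
    (hη : ContinuousOn η (Icc a b)) (hκ : IntegrableOn κ (Ioo a b))
    (h : ∀ s ∈ Icc a b, ∀ t ∈ Icc a b,
      ‖η t‖ ^ 2 - ‖η s‖ ^ 2 = 2 * ∫ r in s..t, inner ℝ (κ r) (η r))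
    {s t : ℝ} (hs : s ∈ Icc a b) (ht : t ∈ Icc a b) :
    ‖η t‖ ≤ ‖η s‖ + 2 * ∫ r in Ioo a b, ‖κ r‖ := by
  have hκ' : IntervalIntegrable κ volume a b :=
    (intervalIntegrable_iff_integrableOn_Ioo_of_le hab).2 hκ
  have := le_add_two_mul_integral (e := fun t => ‖η t‖) (κ := fun t => ‖κ t‖) hab hη.norm
    (fun _ => norm_nonneg _) (fun _ => norm_nonneg _) hκ'.norm (fun s hs t ht => by
      have h1 : |∫ r in s..t, inner ℝ (κ r) (η r)| ≤ |∫ r in s..t, ‖κ r‖ * ‖η r‖| := by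
        have hi : IntervalIntegrable (fun r => ‖κ r‖ * ‖η r‖) volume s t :=
          (intervalIntegrable_of_subset hκ' hab hs ht).norm.mul_continuousOn
            (hη.norm.mono (uIcc_subset_Icc hs ht))
        refine intervalIntegral.norm_integral_le_abs_of_norm_le
          (Eventually.of_forall fun r => norm_inner_le_norm (𝕜 := ℝ) (κ r) (η r)) hi
      rw [abs_mul, abs_two]
      have h2 := h s hs t ht
      have h3 := le_abs_self (∫ r in s..t, inner ℝ (κ r) (η r))
      linarith) hs ht
  rwa [intervalIntegral.integral_of_le hab, integral_Ioc_eq_integral_Ioo] at this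

/-- Weak solutions of `(S ξ)' = ξ + S k` with `S` a bounded skew-adjoint operator have a continuous
representative, which satisfies the energy identity. -/
theorem exists_continuous_representative [CompleteSpace E] {S : E →L[ℝ] E}
    (hS : ∀ x, inner ℝ (S x) x = 0) {a b : ℝ} (hab : a < b) {ξ k : ℝ → E}
    (hξ : IntegrableOn ξ (Ioo a b)) (hk : IntegrableOn k (Ioo a b))
    (hkS : ∀ t n, S n = 0 → inner ℝ n (k t) = 0) {D : Set E} (hD : Dense D)
    (h : ∀ e ∈ D, ∀ θ, IsTestFunction (Ioo a b) θ →
      ∫ t in Ioo a b, deriv θ t * inner ℝ e (S (ξ t)) =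
        -∫ t in Ioo a b, θ t * inner ℝ e (ξ t + S (k t))) :
    ∃ w : ℝ → E, w =ᵐ[volume.restrict (Ioo a b)] ξ ∧ ContinuousOn w (Icc a b) ∧
      (∀ s ∈ Icc a b, ∀ t ∈ Icc a b, S (w t) - S (w s) = ∫ r in s..t, (w r + S (k r))) ∧
      ∀ s ∈ Icc a b, ∀ t ∈ Icc a b,
        ‖w t‖ ^ 2 - ‖w s‖ ^ 2 = 2 * ∫ r in s..t, inner ℝ (k r) (w r) := by
  have hSξ : IntegrableOn (fun t => S (ξ t)) (Ioo a b) := S.integrable_comp hξ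
  have hSk : IntegrableOn (fun t => S (k t)) (Ioo a b) := S.integrable_comp hk
  have hm : IntegrableOn (fun t => ξ t + S (k t)) (Ioo a b) := hξ.add hSk
  have hvec : ∀ θ, IsTestFunction (Ioo a b) θ →
      ∫ t in Ioo a b, deriv θ t • S (ξ t) = -∫ t in Ioo a b, θ t • (ξ t + S (k t)) := by
    intro θ hθ
    have hθ' : Continuous (deriv θ) := hθ.contDiff.continuous_deriv (by simp)
    refine hD.eq_of_inner_right ℝ fun e he => ?_
    rw [inner_neg_right, ← integral_inner (integrableOn_smul_of_hasCompactSupport hθ'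
      hθ.hasCompactSupport.deriv hSξ), ← integral_inner (integrableOn_smul_of_hasCompactSupport
      hθ.contDiff.continuous hθ.hasCompactSupport hm)]
    simp only [real_inner_smul_right]
    exact h e he θ hθ
  -- `ξ` takes its values in the closure of the range of `S`
  have hξS : ∀ᵐ t ∂volume.restrict (Ioo a b), ∀ n, S n = 0 → inner ℝ n (ξ t) = 0 := by
    have hN : ∀ n, S n = 0 → ∀ x, inner ℝ n (S x) = 0 := fun n hn x => by
      have := inner_skew hS n x
      rw [hn, inner_zero_left] at this
      linarith
    let N : Submodule ℝ E := S.toLinearMap.ker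
    have : CompleteSpace N := S.isClosed_ker.completeSpace_coe
    -- Projecting onto the whole kernel produces one null set valid for all `n` at once.
    have hP : IntegrableOn (fun t => N.orthogonalProjectionOnto (ξ t)) (Ioo a b) :=
      (N.orthogonalProjectionOnto).integrable_comp hξ
    have h0 : ∀ᵐ t, t ∈ Ioo a b → N.orthogonalProjectionOnto (ξ t) = 0 := by
      refine isOpen_Ioo.ae_eq_zero_of_integral_contDiff_smul_eq_zero hP.locallyIntegrableOn
        fun θ h1 h2 h3 => ?_
      have hθ : IsTestFunction (Ioo a b) θ := ⟨h1, h2, h3⟩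
      have hθξ := integrableOn_smul_of_hasCompactSupport h1.continuous h2 hξ
      have hθk := integrableOn_smul_of_hasCompactSupport h1.continuous h2 hSk
      have e0 : ∫ t, θ t • N.orthogonalProjectionOnto (ξ t) =
          ∫ t in Ioo a b, θ t • N.orthogonalProjectionOnto (ξ t) := by
        rw [setIntegral_eq_integral_of_forall_compl_eq_zero]
        intro x hx
        rw [image_eq_zero_of_notMem_tsupport fun h' => hx (h3 h'), zero_smul]
      rw [e0]
      simp only [← map_smul]
      rw [(N.orthogonalProjectionOnto).integral_comp_comm hθξ,
        Submodule.orthogonalProjectionOnto_eq_zero_iff, Submodule.mem_orthogonal]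
      intro n hn
      -- Pairing with `n` in the kernel kills every term containing `S`, leaving ∫θ⟨n, ξ⟩ = 0.
      have h4 := congrArg (fun v => inner ℝ n v) (hvec θ hθ)
      have hθ' : Continuous (deriv θ) := h1.continuous_deriv (by simp)
      simp only [smul_add] at h4
      rw [integral_add hθξ hθk] at h4
      simp only [inner_neg_right, inner_add_right] at h4
      rw [← integral_inner hθk, ← integral_inner (integrableOn_smul_of_hasCompactSupport hθ'
        h2.deriv hSξ)] at h4
      simp only [real_inner_smul_right, hN n hn, mul_zero, integral_zero, add_zero] at h4
      linarith
    rw [ae_restrict_iff' measurableSet_Ioo]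
    filter_upwards [h0] with t ht hts n hn
    exact (Submodule.mem_orthogonal _ _).1
      ((Submodule.orthogonalProjectionOnto_eq_zero_iff).1 (ht hts)) n hn
  obtain ⟨c, hc⟩ := exists_ae_eq_primitive hab hSξ hm hvec
  have hε : ∀ n : ℕ, (0 : ℝ) < 1 / ((n : ℝ) + 1) := fun n => by positivity
  choose R hR1 hR2 hR3 hR4 using fun n => exists_resolvent_of_skew hS (hε n)
  have hJ : ∀ n x, ‖(-R n) (S x)‖ ≤ ‖x‖ := fun n x => by
    rw [neg_apply, norm_neg, hR2]
    exact hR4 n x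
  have hlim : ∀ x, (∀ n, S n = 0 → inner ℝ n x = 0) →
      Tendsto (fun n => (-R n) (S x)) atTop (𝓝 x) := by
    intro x hx
    rw [Metric.tendsto_atTop]
    intro δ hδ
    obtain ⟨_, ⟨z, rfl⟩, hz⟩ := Metric.mem_closure_iff.1 (mem_closure_range_of_skew hS hx) (δ / 2)
      (by positivity)
    obtain ⟨n₀, hn₀⟩ := exists_nat_gt (‖z‖ / (δ / 2))
    refine ⟨n₀, fun n hn => ?_⟩
    have e1 : (-R n) (S x) - x = -((1 / ((n : ℝ) + 1)) • R n x) := by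
      have := hR1 n x
      rw [neg_apply, hR2]
      nth_rewrite 2 [← this]
      abel
    -- Splitting x = (x - Sz) + Sz: εR is a contraction on the small first part, while εRSz has norm
    -- at most ε‖z‖.
    have e2 : (1 / ((n : ℝ) + 1)) • R n x =
        (1 / ((n : ℝ) + 1)) • R n (x - S z) + (1 / ((n : ℝ) + 1)) • S (R n z) := by
      rw [map_sub, hR2, smul_sub]
      abel
    rw [dist_eq_norm, e1, norm_neg, e2]
    have e3 : ‖(1 / ((n : ℝ) + 1)) • S (R n z)‖ ≤ (1 / ((n : ℝ) + 1)) * ‖z‖ := by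
      rw [norm_smul, Real.norm_of_nonneg (hε n).le]
      exact mul_le_mul_of_nonneg_left (hR4 n z) (hε n).le
    have e4 : (1 / ((n : ℝ) + 1)) * ‖z‖ < δ / 2 := by
      have : (n₀ : ℝ) ≤ n := by exact_mod_cast hn
      rw [div_lt_iff₀ (by positivity)] at hn₀
      rw [one_div, inv_mul_lt_iff₀ (by positivity)]
      nlinarith
    have e5 := hR3 n (x - S z)
    rw [dist_eq_norm] at hz
    linarith [norm_add_le ((1 / ((n : ℝ) + 1)) • R n (x - S z)) ((1 / ((n : ℝ) + 1)) • S (R n z))]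
  -- The absolutely continuous representative of Sξ; the regularizations of ξ are -Rₙ Z.
  let Z : ℝ → E := fun t => c + ∫ r in a..t, (ξ r + S (k r))
  have hen := fun n => energy_identity_of_commute (M := -R n) hS
    (fun x => by simp [hR2]) hab.le hξ hk hc (η := fun t => (-R n) (Z t)) (fun t => rfl)
  have hdiff := fun n m => energy_identity_of_commute (M := -R n - -R m) hS
    (fun x => by simp [hR2]) hab.le hξ hk hc (η := fun t => (-R n - -R m) (Z t)) (fun t => rfl)
  have hae := ae_all_iff.2 fun n => (hen n).2.1
  -- One good time suffices as initial time, because the energy estimate runs in both time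
  -- directions.
  obtain ⟨s₀, hs₀, hs₀I, hs₀e⟩ : ∃ s₀, (∀ n, S n = 0 → inner ℝ n (ξ s₀) = 0) ∧ s₀ ∈ Ioo a b ∧
      ∀ n, (-R n) (Z s₀) = (-R n) (S (ξ s₀)) := by
    have hne : NeBot (ae (volume.restrict (Ioo a b))) := by
      rw [ae_neBot, Ne, Measure.restrict_eq_zero]
      simp [hab]
    obtain ⟨s, h1, h2, h3⟩ := (hξS.and ((ae_restrict_mem measurableSet_Ioo).and hae)).exists
    exact ⟨s, h1, h2, h3⟩
  have hs₀' : s₀ ∈ Icc a b := Ioo_subset_Icc_self hs₀I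
  have hJk : ∀ n, IntegrableOn (fun r => (-R n) (S (k r))) (Ioo a b) := fun n =>
    (-R n).integrable_comp hSk
  -- The regularization error of the data: value at `s₀` plus forcing in L¹. It controls the error
  -- at all times.
  let α : ℕ → ℝ := fun n => ‖(-R n) (S (ξ s₀)) - ξ s₀‖ +
    2 * ∫ r in Ioo a b, ‖(-R n) (S (k r)) - k r‖
  have hα0 : Tendsto α atTop (𝓝 0) := by
    have h1 : Tendsto (fun n => ‖(-R n) (S (ξ s₀)) - ξ s₀‖) atTop (𝓝 0) :=
      tendsto_iff_norm_sub_tendsto_zero.1 (hlim _ hs₀)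
    have h2 : Tendsto (fun n => ∫ r in Ioo a b, ‖(-R n) (S (k r)) - k r‖) atTop
        (𝓝 (∫ r in Ioo a b, (0 : ℝ))) := by
      refine tendsto_integral_of_dominated_convergence (fun r => 2 * ‖k r‖)
        (fun n => ((hJk n).sub hk).norm.aestronglyMeasurable) (hk.norm.const_mul 2)
        (fun n => Eventually.of_forall fun r => ?_) (Eventually.of_forall fun r => ?_)
      · rw [norm_norm]
        linarith [norm_sub_le ((-R n) (S (k r))) (k r), hJ n (k r)]
      · exact tendsto_iff_norm_sub_tendsto_zero.1 (hlim _ (hkS r))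
    have := h1.add (h2.const_mul 2)
    simpa only [integral_zero, mul_zero, add_zero] using this
  have hcauchy : ∀ n m, ∀ t ∈ Icc a b, ‖(-R n) (Z t) - (-R m) (Z t)‖ ≤ α n + α m := by
    intro n m t ht
    have h1 := norm_le_add_of_energy_identity hab.le
      (by simpa only [uIcc_of_le hab.le] using (hdiff n m).1.continuousOn)
      ((-R n - -R m).integrable_comp hSk) (hdiff n m).2.2 hs₀' ht
    have h2 : ‖(-R n - -R m) (Z s₀)‖ ≤
        ‖(-R n) (S (ξ s₀)) - ξ s₀‖ + ‖(-R m) (S (ξ s₀)) - ξ s₀‖ := by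
      rw [sub_apply, hs₀e, hs₀e, ← sub_sub_sub_cancel_right _ _ (ξ s₀)]
      exact norm_sub_le _ _
    have h3 : ∫ r in Ioo a b, ‖(-R n - -R m) (S (k r))‖ ≤
        (∫ r in Ioo a b, ‖(-R n) (S (k r)) - k r‖) +
          ∫ r in Ioo a b, ‖(-R m) (S (k r)) - k r‖ := by
      rw [← integral_add (by exact ((hJk n).sub hk).norm) (by exact ((hJk m).sub hk).norm)]
      refine integral_mono ((-R n - -R m).integrable_comp hSk).norm
        (((hJk n).sub hk).norm.add ((hJk m).sub hk).norm) fun r => ?_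
      simp only [sub_apply (-R n)]
      rw [← sub_sub_sub_cancel_right _ _ (k r)]
      exact norm_sub_le _ _
    rw [← sub_apply]
    simp only [α]
    linarith
  have hlimit : ∀ t ∈ Icc a b, ∃ x, Tendsto (fun n => (-R n) (Z t)) atTop (𝓝 x) := by
    intro t ht
    refine cauchySeq_tendsto_of_complete (Metric.cauchySeq_iff'.2 fun δ hδ => ?_)
    obtain ⟨n₀, hn₀⟩ := (hα0.eventually (gt_mem_nhds (half_pos hδ))).exists_forall_of_atTop
    refine ⟨n₀, fun n hn => ?_⟩
    rw [dist_eq_norm]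
    linarith [hcauchy n n₀ t ht, hn₀ n hn, hn₀ n₀ le_rfl]
  choose! w hw using hlimit
  have hunif : ∀ n, ∀ t ∈ Icc a b, ‖(-R n) (Z t) - w t‖ ≤ α n := by
    intro n t ht
    have h1 : Tendsto (fun m => ‖(-R n) (Z t) - (-R m) (Z t)‖) atTop (𝓝 ‖(-R n) (Z t) - w t‖) :=
      (tendsto_const_nhds.sub (hw t ht)).norm
    have h2 : Tendsto (fun m => α n + α m) atTop (𝓝 (α n + 0)) := tendsto_const_nhds.add hα0
    rw [add_zero] at h2
    exact le_of_tendsto_of_tendsto' h1 h2 fun m => hcauchy n m t ht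
  have hcont : ∀ n, ContinuousOn (fun t => (-R n) (Z t)) (Icc a b) := fun n => by
    simpa only [uIcc_of_le hab.le] using (hen n).1.continuousOn
  have hwc : ContinuousOn w (Icc a b) := by
    have hu : TendstoUniformlyOn (fun n t => (-R n) (Z t)) w atTop (Icc a b) := by
      rw [Metric.tendstoUniformlyOn_iff]
      intro δ hδ
      filter_upwards [hα0.eventually (gt_mem_nhds hδ)] with n hn t ht
      rw [dist_comm, dist_eq_norm]
      exact (hunif n t ht).trans_lt hn
    exact hu.continuousOn (Frequently.of_forall hcont)
  have hwae : w =ᵐ[volume.restrict (Ioo a b)] ξ := by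
    filter_upwards [hae, hξS, ae_restrict_mem measurableSet_Ioo] with t h1 h2 h3
    refine tendsto_nhds_unique (hw t (Ioo_subset_Icc_self h3)) ?_
    simp only [h1]
    exact hlim _ h2
  have hm' : IntervalIntegrable (fun r => ξ r + S (k r)) volume a b :=
    (intervalIntegrable_iff_integrableOn_Ioo_of_le hab.le).2 hm
  -- Two continuous functions that agree a.e. on the interval agree everywhere on it.
  have hZ : EqOn (fun t => S (w t)) Z (Icc a b) := by
    refine Measure.eqOn_Icc_of_ae_eq (μ := volume) hab.ne ?_ (S.continuous.comp_continuousOn hwc) ?_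
    · rw [← restrict_Ioo_eq_restrict_Icc]
      filter_upwards [hwae, hc] with t h1 h2
      rw [h1, h2]
    · simpa only [uIcc_of_le hab.le] using
        (absolutelyContinuousOnInterval_primitive hab.le hm' c).continuousOn
  refine ⟨w, hwae, hwc, fun s hs t ht => ?_, fun s hs t ht => ?_⟩
  · have ha : a ∈ Icc a b := left_mem_Icc.2 hab.le
    have e1 : S (w t) = Z t := hZ ht
    have e2 : S (w s) = Z s := hZ hs
    rw [e1, e2, add_sub_add_left_eq_sub,
      intervalIntegral.integral_interval_sub_left (intervalIntegrable_of_subset hm' hab.le ha ht)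
      (intervalIntegrable_of_subset hm' hab.le ha hs)]
    refine intervalIntegral.integral_congr_ae ?_
    -- The integral runs over a subset of `Ioc a b`, so only the right endpoint has to be discarded.
    have h1 : ∀ᵐ x : ℝ, x ≠ b := by simp [ae_iff, measure_singleton]
    filter_upwards [(ae_restrict_iff' measurableSet_Ioo).1 hwae, h1] with r hr hrb hrs
    have h2 : r ∈ Ioc a b := Ioc_subset_Ioc (le_min hs.1 ht.1) (max_le hs.2 ht.2) hrs
    rw [hr ⟨h2.1, lt_of_le_of_ne h2.2 hrb⟩]
  obtain ⟨B, hB⟩ := isCompact_Icc.exists_bound_of_continuousOn hwc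
  obtain ⟨A, hA⟩ := hα0.bddAbove_range
  have hk' : IntervalIntegrable k volume a b :=
    (intervalIntegrable_iff_integrableOn_Ioo_of_le hab.le).2 hk
  have hks := intervalIntegrable_of_subset hk' hab.le hs ht
  have hsub : uIoc s t ⊆ Icc a b := uIoc_subset_uIcc.trans (uIcc_subset_Icc hs ht)
  have h1 : Tendsto (fun n => ‖(-R n) (Z t)‖ ^ 2 - ‖(-R n) (Z s)‖ ^ 2) atTop
      (𝓝 (‖w t‖ ^ 2 - ‖w s‖ ^ 2)) := ((hw t ht).norm.pow 2).sub ((hw s hs).norm.pow 2)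
  have h2 : Tendsto (fun n => 2 * ∫ r in s..t, inner ℝ ((-R n) (S (k r))) ((-R n) (Z r))) atTop
      (𝓝 (2 * ∫ r in s..t, inner ℝ (k r) (w r))) := by
    refine Tendsto.const_mul 2 (intervalIntegral.tendsto_integral_filter_of_dominated_convergence
      (fun r => (B + A) * ‖k r‖) (Eventually.of_forall fun n => ?_)
      (Eventually.of_forall fun n => Eventually.of_forall fun r hr => ?_)
      (hks.norm.const_mul _) (Eventually.of_forall fun r hr => ?_))
    · exact (((-R n).comp S).continuous.comp_aestronglyMeasurable
        hks.def'.aestronglyMeasurable).inner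
        (((hcont n).mono hsub).aestronglyMeasurable measurableSet_uIoc)
    · refine (norm_inner_le_norm _ _).trans ?_
      rw [mul_comm]
      have e1 := hunif n r (hsub hr)
      have e2 := hB r (hsub hr)
      have e3 : α n ≤ A := hA ⟨n, rfl⟩
      have e4 : ‖(-R n) (Z r)‖ ≤ B + A := by
        have := norm_add_le (w r) ((-R n) (Z r) - w r)
        rw [add_sub_cancel] at this
        linarith
      exact mul_le_mul e4 (hJ n _) (norm_nonneg _) ((norm_nonneg _).trans e4)
    · exact (hlim _ (hkS r)).inner (hw r (hsub hr))
  exact tendsto_nhds_unique h1 (h2.congr fun n => ((hen n).2.2 s hs t ht).symm)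

end SkewEvolution

/-! ### The space H¹₀(Ω), density of test functions and the Sobolev embedding. -/

section Sobolev

variable {Ω : Set Space}

instance : CompleteSpace (H10 Ω) :=
  (Submodule.isClosed_topologicalClosure _).completeSpace_coe

variable (Ω) in
/-- The embedding `H¹₀(Ω) → L²(Ω)`. -/
def valCLM : H10 Ω →L[ℝ] L2 Ω :=
  (WithLp.fstL 2 ℝ (L2 Ω) (L2Vec Ω)).comp (H10 Ω).subtypeL

variable (Ω) in
/-- The gradient `H¹₀(Ω) → L²(Ω; ℝ³)`. -/
def gradCLM : H10 Ω →L[ℝ] L2Vec Ω :=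
  (WithLp.sndL 2 ℝ (L2 Ω) (L2Vec Ω)).comp (H10 Ω).subtypeL

theorem H10_inner (u v : H10 Ω) :
    inner ℝ u v = inner ℝ (valL2 u) (valL2 v) + inner ℝ (gradL2 u) (gradL2 v) := rfl

theorem H10_norm_sq (u : H10 Ω) : ‖u‖ ^ 2 = ‖valL2 u‖ ^ 2 + ‖gradL2 u‖ ^ 2 :=
  WithLp.prod_norm_sq_eq_of_L2 (u : WithLp 2 (L2 Ω × L2Vec Ω))

theorem continuous_gradient {φ : Space → ℝ} (hφ : ContDiff ℝ ∞ φ) : Continuous (gradient φ) :=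
  (InnerProductSpace.toDual ℝ Space).symm.continuous.comp (hφ.continuous_fderiv (by simp))

theorem hasCompactSupport_gradient {φ : Space → ℝ} (hφ : HasCompactSupport φ) :
    HasCompactSupport (gradient φ) :=
  (hφ.fderiv (𝕜 := ℝ)).comp_left (g := (InnerProductSpace.toDual ℝ Space).symm) (map_zero _)

theorem gradient_add_of_contDiff {φ ψ : Space → ℝ} (hφ : ContDiff ℝ ∞ φ) (hψ : ContDiff ℝ ∞ ψ) :
    gradient (φ + ψ) = gradient φ + gradient ψ := by
  funext x
  simp only [gradient, Pi.add_apply]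
  rw [fderiv_add (hφ.differentiable (by simp) x) (hψ.differentiable (by simp) x), map_add]

theorem gradient_const_smul_of_contDiff (c : ℝ) {φ : Space → ℝ} (hφ : ContDiff ℝ ∞ φ) :
    gradient (c • φ) = c • gradient φ := by
  funext x
  simp only [gradient, Pi.smul_apply]
  rw [fderiv_const_smul (hφ.differentiable (by simp) x), map_smul]

theorem IsTestFunction.memLp {φ : Space → ℝ} (hφ : IsTestFunction Ω φ) (p : ENNReal) :
    MemLp φ p (volume.restrict Ω) :=
  (hφ.contDiff.continuous.memLp_of_hasCompactSupport hφ.hasCompactSupport).restrict Ω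

theorem IsTestFunction.memLp_gradient {φ : Space → ℝ} (hφ : IsTestFunction Ω φ) (p : ENNReal) :
    MemLp (gradient φ) p (volume.restrict Ω) :=
  ((continuous_gradient hφ.contDiff).memLp_of_hasCompactSupport
    (hasCompactSupport_gradient hφ.hasCompactSupport)).restrict Ω

theorem isTestFunction_zero : IsTestFunction Ω (0 : Space → ℝ) where
  contDiff := contDiff_const
  hasCompactSupport := HasCompactSupport.zero
  tsupport_subset := by simp

variable (Ω) in
/-- The pairs `(φ, ∇φ)` with `φ` a test function. -/
def testPairs : Submodule ℝ (WithLp 2 (L2 Ω × L2Vec Ω)) where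
  carrier := {w | ∃ φ : Space → ℝ, IsTestFunction Ω φ ∧
    (w.fst : Space → ℝ) =ᵐ[volume.restrict Ω] φ ∧
    (w.snd : Space → Space) =ᵐ[volume.restrict Ω] gradient φ}
  add_mem' := by
    rintro v w ⟨φ, hφ, h1, h2⟩ ⟨ψ, hψ, h3, h4⟩
    refine ⟨φ + ψ, hφ.add hψ, (Lp.coeFn_add _ _).trans (h1.add h3), ?_⟩
    rw [gradient_add_of_contDiff hφ.contDiff hψ.contDiff]
    exact (Lp.coeFn_add _ _).trans (h2.add h4)
  zero_mem' := by
    refine ⟨0, isTestFunction_zero, Lp.coeFn_zero _ _ _, ?_⟩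
    have : gradient (0 : Space → ℝ) = 0 := funext fun x => gradient_const x 0
    rw [this]
    exact Lp.coeFn_zero _ _ _
  smul_mem' := by
    rintro c w ⟨φ, hφ, h1, h2⟩
    refine ⟨c • φ, hφ.const_smul c, (Lp.coeFn_smul _ _).trans (h1.const_smul c), ?_⟩
    rw [gradient_const_smul_of_contDiff c hφ.contDiff]
    exact (Lp.coeFn_smul _ _).trans (h2.const_smul c)

theorem H10_eq_topologicalClosure : H10 Ω = (testPairs Ω).topologicalClosure := by
  rw [H10]
  congr 1
  exact Submodule.span_eq (testPairs Ω)

/-- Test functions are dense in `H¹₀(Ω)`. -/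
theorem dense_testFunctions_H10 : Dense {u : H10 Ω | ∃ φ : Space → ℝ, IsTestFunction Ω φ ∧
    (valL2 u : Space → ℝ) =ᵐ[volume.restrict Ω] φ ∧
    (gradL2 u : Space → Space) =ᵐ[volume.restrict Ω] gradient φ} := by
  refine Subtype.dense_iff.2 fun w hw => ?_
  have hw' : w ∈ closure (testPairs Ω : Set (WithLp 2 (L2 Ω × L2Vec Ω))) := by
    rw [← Submodule.topologicalClosure_coe, ← H10_eq_topologicalClosure]
    exact hw
  refine closure_mono (fun v hv => ?_) hw'
  refine ⟨⟨v, ?_⟩, hv, rfl⟩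
  rw [H10_eq_topologicalClosure]
  exact Submodule.le_topologicalClosure _ hv

variable (Ω) in
/-- The test functions as elements of `L²(Ω)`. -/
def testL2 : Submodule ℝ (L2 Ω) where
  carrier := {v | ∃ φ : Space → ℝ, IsTestFunction Ω φ ∧ (v : Space → ℝ) =ᵐ[volume.restrict Ω] φ}
  add_mem' := by
    rintro v w ⟨φ, hφ, h1⟩ ⟨ψ, hψ, h3⟩
    exact ⟨φ + ψ, hφ.add hψ, (Lp.coeFn_add _ _).trans (h1.add h3)⟩
  zero_mem' := ⟨0, isTestFunction_zero, Lp.coeFn_zero _ _ _⟩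
  smul_mem' := by
    rintro c w ⟨φ, hφ, h1⟩
    exact ⟨c • φ, hφ.const_smul c, (Lp.coeFn_smul _ _).trans (h1.const_smul c)⟩

theorem L2_inner_eq_integral {v w : L2 Ω} {ψ φ : Space → ℝ}
    (hv : (v : Space → ℝ) =ᵐ[volume.restrict Ω] ψ)
    (hw : (w : Space → ℝ) =ᵐ[volume.restrict Ω] φ) :
    inner ℝ v w = ∫ x in Ω, φ x * ψ x := by
  rw [L2.inner_def]
  refine integral_congr_ae ?_
  filter_upwards [hv, hw] with x h1 h2
  rw [h1, h2, RCLike.inner_apply]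
  rfl

/-- Test functions are dense in `L²(Ω)`. -/
theorem dense_testFunctions_L2 (hΩ : IsOpen Ω) : Dense (testL2 Ω : Set (L2 Ω)) := by
  rw [Submodule.dense_iff_topologicalClosure_eq_top, Submodule.topologicalClosure_eq_top_iff,
    Submodule.eq_bot_iff]
  intro v hv
  rw [Submodule.mem_orthogonal] at hv
  have hloc : LocallyIntegrableOn (v : Space → ℝ) Ω volume := by
    rw [locallyIntegrableOn_iff hΩ.isLocallyClosed]
    intro K hK hKc
    have h1 : MemLp (v : Space → ℝ) 2 (volume.restrict K) := by
      have := (Lp.memLp v).restrict K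
      rwa [Measure.restrict_restrict_of_subset hK] at this
    have : IsFiniteMeasure (volume.restrict K) := ⟨by simpa using hKc.measure_lt_top⟩
    exact h1.integrable (by norm_num)
  have h0 := hΩ.ae_eq_zero_of_integral_contDiff_smul_eq_zero hloc fun φ h1 h2 h3 => by
    have hφ : IsTestFunction Ω φ := ⟨h1, h2, h3⟩
    have h4 := hv ((hφ.memLp 2).toLp φ) ⟨φ, hφ, (hφ.memLp 2).coeFn_toLp⟩
    rw [L2_inner_eq_integral (hφ.memLp 2).coeFn_toLp (EventuallyEq.refl _ _)] at h4
    rw [← setIntegral_eq_integral_of_forall_compl_eq_zero (s := Ω), ← h4]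
    · simp only [smul_eq_mul, mul_comm]
    · intro x hx
      rw [image_eq_zero_of_notMem_tsupport fun h' => hx (h3 h'), zero_smul]
  rw [Lp.eq_zero_iff_ae_eq_zero]
  exact (ae_restrict_iff' hΩ.measurableSet).2 h0

/-- The Sobolev embedding `H¹₀(Ω) ⊂ L⁶(Ω)`. -/
theorem exists_sobolev_const (Ω : Set Space) : ∃ C : NNReal, ∀ u : H10 Ω,
    eLpNorm (valL2 u) 6 (volume.restrict Ω) ≤ C * ‖gradL2 u‖ₑ := by
  let C := SNormLESNormFDerivOfEqConst ℝ (volume : Measure Space) 2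
  have htest : ∀ u : H10 Ω, (∃ φ : Space → ℝ, IsTestFunction Ω φ ∧
      (valL2 u : Space → ℝ) =ᵐ[volume.restrict Ω] φ ∧
      (gradL2 u : Space → Space) =ᵐ[volume.restrict Ω] gradient φ) →
      eLpNorm (valL2 u) 6 (volume.restrict Ω) ≤ C * ‖gradL2 u‖ₑ := by
    rintro u ⟨φ, hφ, h1, h2⟩
    rw [Lp.enorm_def, eLpNorm_congr_ae h1, eLpNorm_congr_ae h2]
    -- Gagliardo–Nirenberg–Sobolev in dimension 3: 1/6 = 1/2 - 1/3.
    have h3 := eLpNorm_le_eLpNorm_fderiv_of_eq (F := ℝ) (volume : Measure Space)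
      (hφ.contDiff.of_le (by simp)) hφ.hasCompactSupport (p := 2) (p' := 6) (by norm_num)
      (by simp) (by simp; norm_num)
    have h4 : eLpNorm (gradient φ) 2 (volume.restrict Ω) = eLpNorm (fderiv ℝ φ) 2 volume := by
      rw [eLpNorm_restrict_eq_of_support_subset]
      · refine eLpNorm_congr_norm_ae (Eventually.of_forall fun x => ?_)
        exact LinearIsometryEquiv.norm_map _ _
      · intro x hx
        refine hφ.tsupport_subset (support_fderiv_subset ℝ (f := φ) fun h0 => hx ?_)
        simp [gradient, h0]
    rw [h4]
    refine (eLpNorm_mono_measure _ Measure.restrict_le_self).trans ?_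
    exact_mod_cast h3
  refine ⟨C, fun u => ?_⟩
  obtain ⟨v, hv, hvu⟩ := mem_closure_iff_seq_limit.1 (dense_testFunctions_H10 u)
  have hval : Tendsto (fun n => valL2 (v n)) atTop (𝓝 (valL2 u)) :=
    ((valCLM Ω).continuous.tendsto u).comp hvu
  have hgrad : Tendsto (fun n => gradL2 (v n)) atTop (𝓝 (gradL2 u)) :=
    ((gradCLM Ω).continuous.tendsto u).comp hvu
  -- By density and Fatou along an a.e. convergent subsequence, the inequality passes from test
  -- functions to H¹₀.
  obtain ⟨ns, hns, hae⟩ := (tendstoInMeasure_of_tendsto_Lp hval).exists_seq_tendsto_ae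
  refine (Lp.eLpNorm_lim_le_liminf_eLpNorm (fun n => Lp.aestronglyMeasurable (valL2 (v (ns n)))) _
    hae).trans ?_
  have hlim : Tendsto (fun n => (C : ENNReal) * ‖gradL2 (v (ns n))‖ₑ) atTop
      (𝓝 (C * ‖gradL2 u‖ₑ)) :=
    ENNReal.Tendsto.const_mul ((hgrad.comp hns.tendsto_atTop).enorm) (Or.inr ENNReal.coe_ne_top)
  rw [← hlim.liminf_eq]
  exact liminf_le_liminf (Eventually.of_forall fun n => htest _ (hv _))

end Sobolev

/-! ### Truncated nonlinearities and superposition operators on L². -/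

section Superposition

/-- Truncations of a nonlinearity of quintic growth: globally Lipschitz functions of uniform quintic
growth which coincide with the nonlinearity on large intervals. -/
theorem exists_truncation {f : ℝ → ℝ} (hf : ContDiff ℝ 1 f)
    (hgrowth : ∃ C : ℝ, ∀ s : ℝ, |deriv f s| ≤ C * (1 + |s| ^ 4)) :
    ∃ A : ℝ, 0 ≤ A ∧ (∀ s, |f s| ≤ A * (1 + |s| ^ 5)) ∧ ∃ fn : ℕ → ℝ → ℝ,
      (∀ n, ∃ L : NNReal, LipschitzWith L (fn n)) ∧ (∀ n s, |fn n s| ≤ A * (1 + |s| ^ 5)) ∧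
      ∀ (n : ℕ) (s : ℝ), |s| ≤ n → fn n s = f s := by
  obtain ⟨C, hC⟩ := hgrowth
  have hC0 : 0 ≤ C := by
    have := (abs_nonneg _).trans (hC 0)
    simpa using this
  have hLip : ∀ r : ℝ, ∀ s ∈ Icc (-r) r, ∀ t ∈ Icc (-r) r,
      |f t - f s| ≤ C * (1 + r ^ 4) * |t - s| := by
    intro r s hs t ht
    refine Convex.norm_image_sub_le_of_norm_deriv_le (𝕜 := ℝ) (f := f)
      (fun x _ => hf.differentiable (by simp) x) (fun x hx => (hC x).trans ?_)
      (convex_Icc (-r) r) hs ht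
    have : |x| ≤ r := abs_le.2 hx
    gcongr
  -- The mean value bound C(1 + |s|⁴)|s| is at most 2C(1 + |s|⁵), whence the 2C.
  have hA : ∀ s, |f s| ≤ (|f 0| + 2 * C) * (1 + |s| ^ 5) := by
    intro s
    have h1 := hLip |s| 0 (by simp) s (abs_le.1 le_rfl)
    rw [sub_zero] at h1
    have h2 : |f s| ≤ |f 0| + |f s - f 0| := by
      have := abs_add_le (f 0) (f s - f 0)
      rwa [add_sub_cancel] at this
    have h3 : (1 + |s| ^ 4) * |s| ≤ 2 * (1 + |s| ^ 5) := by
      have h0 := abs_nonneg s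
      rcases le_total |s| 1 with h | h
      · have : |s| ^ 4 * |s| = |s| ^ 5 := by ring
        nlinarith [pow_nonneg h0 5]
      · have : |s| ≤ |s| ^ 5 := le_self_pow₀ h (by norm_num)
        nlinarith
    have h4 : 0 ≤ |f 0| * |s| ^ 5 := by positivity
    nlinarith [mul_le_mul_of_nonneg_left h3 hC0]
  have hcl : ∀ (n : ℕ) (s : ℝ), max (-(n : ℝ)) (min s n) ∈ Icc (-(n : ℝ)) n := fun n s =>
    ⟨le_max_left _ _, max_le (by linarith [n.cast_nonneg (α := ℝ)]) (min_le_right _ _)⟩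
  -- Clamping the argument to [-n, n] does not increase its modulus, so the growth bound is
  -- inherited with the same constant.
  refine ⟨|f 0| + 2 * C, by positivity, hA, fun n s => f (max (-(n : ℝ)) (min s n)),
    fun n => ⟨⟨C * (1 + (n : ℝ) ^ 4), by positivity⟩, LipschitzWith.of_dist_le_mul fun s t => ?_⟩,
    fun n s => (hA _).trans ?_, fun n s hs => ?_⟩
  · rw [Real.dist_eq, Real.dist_eq]
    refine (hLip n _ (hcl n t) _ (hcl n s)).trans ?_
    refine mul_le_mul_of_nonneg_left ?_ (by positivity)
    refine (abs_max_sub_max_le_max _ _ _ _).trans ?_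
    rw [sub_self, abs_zero]
    refine max_le (abs_nonneg _) ((abs_min_sub_min_le_max _ _ _ _).trans ?_)
    simp
  · have : |max (-(n : ℝ)) (min s n)| ≤ |s| := by
      have hn := n.cast_nonneg (α := ℝ)
      rw [abs_le]
      refine ⟨?_, max_le ((neg_nonpos.2 hn).trans (abs_nonneg s)) ((min_le_left _ _).trans
        (le_abs_self s))⟩
      rcases le_total s n with h | h
      · rw [min_eq_left h]
        exact (neg_abs_le s).trans (le_max_right _ _)
      · rw [min_eq_right h]
        exact ((neg_nonpos.2 (abs_nonneg s)).trans hn).trans (le_max_right _ _)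
    gcongr
  · have := abs_le.1 hs
    simp only
    rw [min_eq_left this.2, max_eq_right this.1]

variable {α : Type*} [MeasurableSpace α] {μ : Measure α}

open Classical in
/-- The superposition operator `v ↦ h ∘ v` on `L²`, extended by zero to the functions `v` with
`h ∘ v ∉ L²`. -/
def superposition (h : ℝ → ℝ) (v : Lp ℝ 2 μ) : Lp ℝ 2 μ :=
  if H : MemLp (fun x => h (v x)) 2 μ then H.toLp _ else 0

theorem coeFn_superposition {h : ℝ → ℝ} {v : Lp ℝ 2 μ} (H : MemLp (fun x => h (v x)) 2 μ) :
    superposition h v =ᵐ[μ] fun x => h (v x) := by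
  rw [superposition, dif_pos H]
  exact H.coeFn_toLp

theorem memLp_comp_of_lipschitz [IsFiniteMeasure μ] {h : ℝ → ℝ} {L : NNReal}
    (hL : LipschitzWith L h) (v : Lp ℝ 2 μ) : MemLp (fun x => h (v x)) 2 μ := by
  have h0 : MemLp (fun x => (L : ℝ) * ‖v x‖) 2 μ := (Lp.memLp v).norm.const_mul (L : ℝ)
  have h1 : MemLp (fun x => |h 0| + L * ‖v x‖) 2 μ := (memLp_const |h 0|).add h0
  refine h1.mono (hL.continuous.comp_aestronglyMeasurable (Lp.aestronglyMeasurable v))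
    (Eventually.of_forall fun x => ?_)
  have h2 : |h (v x) - h 0| ≤ L * ‖v x‖ := by
    simpa only [Real.dist_eq, sub_zero, Real.norm_eq_abs] using hL.dist_le_mul (v x) 0
  rw [Real.norm_of_nonneg (by positivity : 0 ≤ |h 0| + L * ‖v x‖), Real.norm_eq_abs]
  have h3 := abs_add_le (h 0) (h (v x) - h 0)
  rw [add_sub_cancel] at h3
  linarith

theorem norm_superposition_sub_le [IsFiniteMeasure μ] {h : ℝ → ℝ} {L : NNReal}
    (hL : LipschitzWith L h) (v w : Lp ℝ 2 μ) :
    ‖superposition h v - superposition h w‖ ≤ L * ‖v - w‖ := by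
  refine Lp.norm_le_mul_norm_of_ae_le_mul ?_
  filter_upwards [Lp.coeFn_sub (superposition h v) (superposition h w), Lp.coeFn_sub v w,
    coeFn_superposition (memLp_comp_of_lipschitz hL v),
    coeFn_superposition (memLp_comp_of_lipschitz hL w)] with x h1 h2 h3 h4
  rw [h1, h2, Pi.sub_apply, Pi.sub_apply, h3, h4]
  simpa only [Real.dist_eq, Real.norm_eq_abs] using hL.dist_le_mul (v x) (w x)

theorem continuous_superposition [IsFiniteMeasure μ] {h : ℝ → ℝ} {L : NNReal}
    (hL : LipschitzWith L h) : Continuous (superposition h : Lp ℝ 2 μ → Lp ℝ 2 μ) :=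
  (LipschitzWith.of_dist_le_mul (K := L) fun v w => by
    rw [dist_eq_norm, dist_eq_norm]
    exact norm_superposition_sub_le hL v w).continuous

/-- A bound of the `L²` norm of `1 + |v|⁵`. -/
def quinticBound (v : Lp ℝ 2 μ) : ENNReal :=
  μ univ ^ (1 / 2 : ℝ) + eLpNorm v 6 μ * eLpNorm v 12 μ ^ 4

/-- Hölder applied to |v|⁵ = |v| · |v|⁴ with exponents 6 and 3, together with ‖|v|⁴‖_{L³} =
‖v‖⁴_{L¹²}. -/
theorem eLpNorm_quintic_le (v : Lp ℝ 2 μ) :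
    eLpNorm (fun x => 1 + |v x| ^ 5) 2 μ ≤ quinticBound v := by
  rcases eq_or_ne μ 0 with rfl | hμ
  · simp
  have hv := Lp.aestronglyMeasurable v
  have h4 : AEStronglyMeasurable (fun x => |v x| ^ 4) μ := hv.norm.pow 4
  refine (eLpNorm_add_le (f := fun _ : α => (1 : ℝ)) (g := fun x => |v x| ^ 5)
    aestronglyMeasurable_const (hv.norm.pow 5) one_le_two).trans ?_
  refine add_le_add ?_ ?_
  · rw [eLpNorm_const _ (by norm_num) hμ]
    simp
  · have : ENNReal.HolderTriple 6 3 2 := ⟨by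
      rw [← ENNReal.toReal_eq_toReal_iff' (by simp) (by simp), ENNReal.toReal_add (by simp)
        (by simp)]
      norm_num [ENNReal.toReal_inv]⟩
    have h1 := eLpNorm_smul_le_mul_eLpNorm (p := 6) (q := 3) (r := 2) h4 hv.norm
    have e1 : ((fun x => ‖v x‖) • fun x => |v x| ^ 4) = fun x => |v x| ^ 5 := by
      funext x
      simp only [Pi.smul_apply', smul_eq_mul, Real.norm_eq_abs]
      ring
    have e2 : eLpNorm (fun x => |v x| ^ 4) 3 μ = eLpNorm v 12 μ ^ 4 := by
      have := eLpNorm_norm_rpow (p := 3) (μ := μ) (q := 4) v (by norm_num)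
      have e3 : (3 : ENNReal) * ENNReal.ofReal 4 = 12 := by
        rw [ENNReal.ofReal_ofNat]; norm_num
      rw [e3] at this
      exact_mod_cast this
    rw [e1, eLpNorm_norm, e2] at h1
    exact h1

theorem memLp_quintic {v : Lp ℝ 2 μ} (hv : quinticBound v ≠ ⊤) :
    MemLp (fun x => 1 + |v x| ^ 5) 2 μ :=
  ⟨aestronglyMeasurable_const.add ((Lp.aestronglyMeasurable v).norm.pow 5),
    (eLpNorm_quintic_le v).trans_lt hv.lt_top⟩

theorem memLp_comp_of_quintic {h : ℝ → ℝ} (hc : Continuous h) {A : ℝ}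
    (hA : ∀ s, |h s| ≤ A * (1 + |s| ^ 5)) {v : Lp ℝ 2 μ} (hv : quinticBound v ≠ ⊤) :
    MemLp (fun x => h (v x)) 2 μ := by
  refine (memLp_quintic hv).of_le_mul (hc.comp_aestronglyMeasurable (Lp.aestronglyMeasurable v))
    (c := A) (Eventually.of_forall fun x => ?_)
  rw [Real.norm_of_nonneg (by positivity : 0 ≤ 1 + |v x| ^ 5)]
  exact hA _

theorem norm_superposition_le {h : ℝ → ℝ} (hc : Continuous h) {A : ℝ} (hA0 : 0 ≤ A)
    (hA : ∀ s, |h s| ≤ A * (1 + |s| ^ 5)) {v : Lp ℝ 2 μ} (hv : quinticBound v ≠ ⊤) :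
    ‖superposition h v‖ ≤ A * (quinticBound v).toReal := by
  have h1 : ‖superposition h v‖ ≤ A * ‖(memLp_quintic hv).toLp _‖ := by
    refine Lp.norm_le_mul_norm_of_ae_le_mul ?_
    filter_upwards [coeFn_superposition (memLp_comp_of_quintic hc hA hv),
      (memLp_quintic hv).coeFn_toLp] with x h1 h2
    rw [h1, h2, Real.norm_of_nonneg (by positivity : 0 ≤ 1 + |v x| ^ 5)]
    exact hA _
  refine h1.trans (mul_le_mul_of_nonneg_left ?_ hA0)
  rw [Lp.norm_toLp]
  exact ENNReal.toReal_mono hv (eLpNorm_quintic_le v)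

/-- Dominated convergence: at each point the difference is zero once n ≥ |v(x)|, and its square is
at most (2A)²(1 + |v|⁵)². -/
theorem tendsto_superposition {f : ℝ → ℝ} {fn : ℕ → ℝ → ℝ} (hf : Continuous f)
    (hfn : ∀ n, Continuous (fn n)) {A : ℝ} (hA : ∀ s, |f s| ≤ A * (1 + |s| ^ 5))
    (hAn : ∀ n s, |fn n s| ≤ A * (1 + |s| ^ 5)) (heq : ∀ (n : ℕ) (s : ℝ), |s| ≤ n → fn n s = f s)
    {v : Lp ℝ 2 μ} (hv : quinticBound v ≠ ⊤) :
    Tendsto (fun n => superposition (fn n) v) atTop (𝓝 (superposition f v)) := by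
  have hsq : Tendsto (fun n => ‖superposition (fn n) v - superposition f v‖ ^ 2) atTop (𝓝 0) := by
    have e : ∀ n, ‖superposition (fn n) v - superposition f v‖ ^ 2 =
        ∫ x, (fn n (v x) - f (v x)) ^ 2 ∂μ := by
      intro n
      rw [← real_inner_self_eq_norm_sq, L2.inner_def]
      refine integral_congr_ae ?_
      filter_upwards [Lp.coeFn_sub (superposition (fn n) v) (superposition f v),
        coeFn_superposition (memLp_comp_of_quintic (hfn n) (hAn n) hv),
        coeFn_superposition (memLp_comp_of_quintic hf hA hv)] with x h1 h2 h3
      rw [h1, Pi.sub_apply, h2, h3, real_inner_self_eq_norm_sq, Real.norm_eq_abs, sq_abs]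
    simp only [e]
    have := tendsto_integral_of_dominated_convergence (μ := μ)
      (F := fun (n : ℕ) x => (fn n (v x) - f (v x)) ^ 2) (f := fun _ => (0 : ℝ))
      (fun x => (2 * A) ^ 2 * (1 + |v x| ^ 5) ^ 2)
      (fun n => (((hfn n).sub hf).comp_aestronglyMeasurable (Lp.aestronglyMeasurable v)).pow 2)
      ((memLp_quintic hv).integrable_sq.const_mul _)
      (fun n => Eventually.of_forall fun x => by
        rw [← mul_pow, Real.norm_of_nonneg (sq_nonneg _), ← sq_abs (fn n (v x) - f (v x))]
        refine pow_le_pow_left₀ (abs_nonneg _) ?_ 2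
        linarith [abs_sub (fn n (v x)) (f (v x)), hA (v x), hAn n (v x)])
      (Eventually.of_forall fun x => by
        obtain ⟨n₀, hn₀⟩ := exists_nat_ge |v x|
        refine tendsto_const_nhds.congr' ?_
        filter_upwards [eventually_ge_atTop n₀] with n hn
        rw [heq n _ (hn₀.trans (by exact_mod_cast hn)), sub_self]
        norm_num)
    simpa using this
  rw [tendsto_iff_norm_sub_tendsto_zero]
  have := hsq.sqrt
  simpa [Real.sqrt_sq] using this

/-- The `Lᵖ` norms are lower semicontinuous functions on `L²`. -/
theorem lowerSemicontinuous_eLpNorm (p : ENNReal) :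
    LowerSemicontinuous fun v : Lp ℝ 2 μ => eLpNorm v p μ := by
  rw [lowerSemicontinuous_iff_isClosed_preimage]
  intro c
  refine IsSeqClosed.isClosed fun v w hv hvw => ?_
  obtain ⟨ns, hns, hae⟩ := (tendstoInMeasure_of_tendsto_Lp hvw).exists_seq_tendsto_ae
  refine (Lp.eLpNorm_lim_le_liminf_eLpNorm (fun n => Lp.aestronglyMeasurable (v (ns n))) _
    hae).trans ?_
  exact (liminf_le_liminf (v := fun _ => c) (Eventually.of_forall fun n => hv (ns n))).trans
    (by simp)

/-- The Lᵖ norm need not be continuous on L², but lower semicontinuity makes it Borel, which is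
enough for measurability in time. -/
theorem aemeasurable_eLpNorm {v : ℝ → Lp ℝ 2 μ} {ν : Measure ℝ} (hv : AEStronglyMeasurable v ν)
    (p : ENNReal) : AEMeasurable (fun t => eLpNorm (v t) p μ) ν := by
  let _ : MeasurableSpace (Lp ℝ 2 μ) := borel _
  have : BorelSpace (Lp ℝ 2 μ) := ⟨rfl⟩
  exact (lowerSemicontinuous_eLpNorm p).measurable.comp_aemeasurable hv.aemeasurable

theorem aemeasurable_quinticBound {v : ℝ → Lp ℝ 2 μ} {ν : Measure ℝ}
    (hv : AEStronglyMeasurable v ν) : AEMeasurable (fun t => quinticBound (v t)) ν :=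
  aemeasurable_const.add ((aemeasurable_eLpNorm hv 6).mul ((aemeasurable_eLpNorm hv 12).pow_const 4))

theorem hasDerivAt_primitive {h : ℝ → ℝ} (hc : Continuous h) (s : ℝ) :
    HasDerivAt (primitive h) (h s) s :=
  intervalIntegral.integral_hasDerivAt_right (hc.intervalIntegrable _ _)
    (hc.stronglyMeasurableAtFilter _ _) hc.continuousAt

theorem continuous_primitive {h : ℝ → ℝ} (hc : Continuous h) : Continuous (primitive h) :=
  continuous_iff_continuousAt.2 fun s => (hasDerivAt_primitive hc s).continuousAt

/-- The remainder is the integral of h(r) - h(s). Being quadratic, it integrates to O(‖w - v‖²) in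
L², which gives Fréchet differentiability there. -/
theorem abs_primitive_sub_sub_le {h : ℝ → ℝ} {L : NNReal} (hL : LipschitzWith L h) (s t : ℝ) :
    |primitive h t - primitive h s - h s * (t - s)| ≤ L * |t - s| ^ 2 := by
  have hc := hL.continuous
  have e : primitive h t - primitive h s - h s * (t - s) = ∫ r in s..t, (h r - h s) := by
    rw [intervalIntegral.integral_sub (hc.intervalIntegrable _ _) (by simp), primitive, primitive,
      intervalIntegral.integral_interval_sub_left (hc.intervalIntegrable _ _)
        (hc.intervalIntegrable _ _), intervalIntegral.integral_const, smul_eq_mul, mul_comm (h s)]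
  rw [e]
  have := intervalIntegral.norm_integral_le_of_norm_le_const (a := s) (b := t)
    (f := fun r => h r - h s) (C := L * |t - s|) fun r hr => by
      have h1 := hL.dist_le_mul r s
      rw [Real.dist_eq, Real.dist_eq] at h1
      refine h1.trans (mul_le_mul_of_nonneg_left ?_ L.2)
      exact abs_sub_left_of_mem_uIcc (uIoc_subset_uIcc hr)
  rw [Real.norm_eq_abs] at this
  linarith [sq |t - s|]

theorem abs_primitive_le {h : ℝ → ℝ} {A : ℝ} (hA0 : 0 ≤ A)
    (hA : ∀ s, |h s| ≤ A * (1 + |s| ^ 5)) (s : ℝ) :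
    |primitive h s| ≤ A * 2 * (1 + |s| ^ 6) := by
  have := intervalIntegral.norm_integral_le_of_norm_le_const (a := 0) (b := s)
    (f := h) (C := A * (1 + |s| ^ 5)) fun r hr => by
      refine (hA r).trans ?_
      have : |r| ≤ |s| := by
        have := abs_sub_left_of_mem_uIcc (uIoc_subset_uIcc hr)
        simpa using this
      gcongr
  rw [Real.norm_eq_abs, sub_zero] at this
  refine this.trans ?_
  have h0 := abs_nonneg s
  have h3 : (1 + |s| ^ 5) * |s| ≤ 2 * (1 + |s| ^ 6) := by
    have e : |s| ^ 5 * |s| = |s| ^ 6 := by ring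
    rcases le_total |s| 1 with h | h
    · nlinarith [pow_nonneg h0 6]
    · have : |s| ≤ |s| ^ 6 := le_self_pow₀ h (by norm_num)
      nlinarith
  nlinarith [mul_le_mul_of_nonneg_left h3 hA0]

theorem integrable_primitive_of_lipschitz [IsFiniteMeasure μ] {h : ℝ → ℝ} {L : NNReal}
    (hL : LipschitzWith L h) (v : Lp ℝ 2 μ) : Integrable (fun x => primitive h (v x)) μ := by
  have h1 : Integrable (fun x => |h 0| * ‖v x‖ + L * ‖v x‖ ^ 2) μ :=
    (((Lp.memLp v).integrable one_le_two).norm.const_mul _).add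
      (((Lp.memLp v).norm.integrable_sq).const_mul _)
  refine h1.mono ((continuous_primitive hL.continuous).comp_aestronglyMeasurable
    (Lp.aestronglyMeasurable v)) (Eventually.of_forall fun x => ?_)
  have h2 := abs_primitive_sub_sub_le hL 0 (v x)
  have h3 : primitive h 0 = 0 := by simp [primitive]
  rw [h3, sub_zero, sub_zero] at h2
  have h4 := abs_add_le (primitive h (v x) - h 0 * v x) (h 0 * v x)
  rw [sub_add_cancel, abs_mul] at h4
  rw [Real.norm_eq_abs, Real.norm_of_nonneg (by positivity)]
  simp only [Real.norm_eq_abs]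
  linarith

/-- The functional `v ↦ ∫ H(v)`, with `H` a primitive of a Lipschitz function `h`, is differentiable
on `L²` with gradient `h(v)`. -/
theorem hasFDerivAt_integral_primitive [IsFiniteMeasure μ] {h : ℝ → ℝ} {L : NNReal}
    (hL : LipschitzWith L h) (v : Lp ℝ 2 μ) :
    HasFDerivAt (fun w : Lp ℝ 2 μ => ∫ x, primitive h (w x) ∂μ)
      (innerSL ℝ (superposition h v)) v := by
  rw [hasFDerivAt_iff_isLittleO]
  refine Asymptotics.IsBigO.trans_isLittleO (.of_bound L (Eventually.of_forall fun w => ?_))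
    (Asymptotics.isLittleO_pow_sub_sub v one_lt_two)
  have hi := L2.integrable_inner (𝕜 := ℝ) (superposition h v) (w - v)
  have hsq : ‖w - v‖ ^ 2 = ∫ x, |w x - v x| ^ 2 ∂μ := by
    rw [← real_inner_self_eq_norm_sq, L2.inner_def]
    refine integral_congr_ae ?_
    filter_upwards [Lp.coeFn_sub w v] with x h1
    rw [h1, Pi.sub_apply, real_inner_self_eq_norm_sq, Real.norm_eq_abs]
  have hsqi : Integrable (fun x => (L : ℝ) * |w x - v x| ^ 2) μ := by
    refine (((Lp.memLp w).sub (Lp.memLp v)).norm.integrable_sq).const_mul _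
  rw [innerSL_apply_apply, L2.inner_def, ← integral_sub (integrable_primitive_of_lipschitz hL w)
    (integrable_primitive_of_lipschitz hL v), ← integral_sub
    (by exact (integrable_primitive_of_lipschitz hL w).sub (integrable_primitive_of_lipschitz hL v))
    hi,
    norm_pow, norm_norm, hsq, ← integral_const_mul]
  refine norm_integral_le_of_norm_le hsqi ?_
  filter_upwards [Lp.coeFn_sub w v, coeFn_superposition (memLp_comp_of_lipschitz hL v)]
    with x h1 h2
  rw [h1, h2, Pi.sub_apply, Real.norm_eq_abs, RCLike.inner_apply, conj_trivial, mul_comm]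
  have := abs_primitive_sub_sub_le hL (v x) (w x)
  rwa [mul_comm] at this ⊢

end Superposition

/-! ### The linear wave equation with forcing in L¹(0, T; L²). -/

section LinearWave

variable {Ω : Set Space}

theorem IsTestFunction.exists_H10 {φ : Space → ℝ} (hφ : IsTestFunction Ω φ) :
    ∃ v : H10 Ω, (valL2 v : Space → ℝ) =ᵐ[volume.restrict Ω] φ ∧
      (gradL2 v : Space → Space) =ᵐ[volume.restrict Ω] gradient φ := by
  let w : WithLp 2 (L2 Ω × L2Vec Ω) :=
    WithLp.toLp 2 ((hφ.memLp 2).toLp φ, (hφ.memLp_gradient 2).toLp (gradient φ))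
  have hw : w ∈ H10 Ω := by
    rw [H10_eq_topologicalClosure]
    exact Submodule.le_topologicalClosure _
      ⟨φ, hφ, (hφ.memLp 2).coeFn_toLp, (hφ.memLp_gradient 2).coeFn_toLp⟩
  exact ⟨⟨w, hw⟩, (hφ.memLp 2).coeFn_toLp, (hφ.memLp_gradient 2).coeFn_toLp⟩

/-- Elements of `L²(Ω)` orthogonal to `H¹₀(Ω)` vanish. -/
theorem eq_zero_of_adjoint_valCLM (hΩ : IsOpen Ω) {b : L2 Ω}
    (hb : ContinuousLinearMap.adjoint (valCLM Ω) b = 0) : b = 0 := by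
  refine (dense_testFunctions_L2 hΩ).eq_of_inner_right ℝ fun e he => ?_
  obtain ⟨φ, hφ, hφe⟩ := he
  obtain ⟨v, hv, -⟩ := hφ.exists_H10
  have : e = valCLM Ω v := Lp.ext (hφe.trans hv.symm)
  rw [this, ← ContinuousLinearMap.adjoint_inner_right, hb, inner_zero_right, inner_zero_right]

variable (Ω) in
/-- The energy space `H¹₀(Ω) × L²(Ω)` as a Hilbert space. -/
abbrev EnergySpace : Type := WithLp 2 (H10 Ω × L2 Ω)

variable (Ω) in
/-- The inverse of the generator `(u, v) ↦ (v, Δu - u)` of the wave group. -/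
def waveInverse : EnergySpace Ω →L[ℝ] EnergySpace Ω :=
  ((WithLp.prodContinuousLinearEquiv 2 ℝ (H10 Ω) (L2 Ω)).symm : H10 Ω × L2 Ω →L[ℝ] _).comp
    ((-((ContinuousLinearMap.adjoint (valCLM Ω)).comp (WithLp.sndL 2 ℝ (H10 Ω) (L2 Ω)))).prod
      ((valCLM Ω).comp (WithLp.fstL 2 ℝ (H10 Ω) (L2 Ω))))

/-- Moving the adjoint to the other side leaves only L² pairings, which the weak formulation can
test; the antisymmetry in `e` and `x` is then visible. -/
theorem inner_waveInverse (e x : EnergySpace Ω) :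
    inner ℝ e (waveInverse Ω x) =
      -inner ℝ (valL2 e.fst) x.snd + inner ℝ e.snd (valL2 x.fst) := by
  rw [WithLp.prod_inner_apply]
  congr 1
  show inner ℝ e.fst (-(ContinuousLinearMap.adjoint (valCLM Ω) x.snd)) = _
  rw [inner_neg_right, ContinuousLinearMap.adjoint_inner_right]
  rfl

theorem inner_waveInverse_self (x : EnergySpace Ω) : inner ℝ (waveInverse Ω x) x = 0 := by
  rw [real_inner_comm, inner_waveInverse, real_inner_comm]
  ring

/-- Weak solutions of the linear wave equation `∂ₜ²u - Δu = h` with `h ∈ L¹(0, T; L²(Ω))` have a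
continuous representative, which satisfies the energy identity. -/
theorem linear_wave (hΩ : IsOpen Ω) {T : ℝ} (hT : 0 < T) {u : ℝ → H10 Ω} {ut h : ℝ → L2 Ω}
    (hu : IntegrableOn u (Ioo 0 T)) (hut : IntegrableOn ut (Ioo 0 T))
    (hh : IntegrableOn h (Ioo 0 T))
    (h1 : ∀ ψ ∈ testL2 Ω, ∀ θ, IsTestFunction (Ioo 0 T) θ →
      ∫ t in Ioo 0 T, deriv θ t * inner ℝ ψ (valL2 (u t)) =
        -∫ t in Ioo 0 T, θ t * inner ℝ ψ (ut t))
    (h2 : ∀ (v : H10 Ω) (φ : Space → ℝ), IsTestFunction Ω φ →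
      (valL2 v : Space → ℝ) =ᵐ[volume.restrict Ω] φ →
      (gradL2 v : Space → Space) =ᵐ[volume.restrict Ω] gradient φ →
      ∀ θ, IsTestFunction (Ioo 0 T) θ →
      ∫ t in Ioo 0 T, deriv θ t * inner ℝ (valL2 v) (ut t) =
        ∫ t in Ioo 0 T, θ t * (inner ℝ (gradL2 v) (gradL2 (u t)) - inner ℝ (valL2 v) (h t))) :
    ∃ (w : ℝ → H10 Ω) (wt : ℝ → L2 Ω),
      w =ᵐ[volume.restrict (Ioo 0 T)] u ∧ wt =ᵐ[volume.restrict (Ioo 0 T)] ut ∧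
      ContinuousOn w (Icc 0 T) ∧ ContinuousOn wt (Icc 0 T) ∧
      (∀ s ∈ Icc 0 T, ∀ t ∈ Icc 0 T, valL2 (w t) - valL2 (w s) = ∫ r in s..t, wt r) ∧
      ∀ s ∈ Icc 0 T, ∀ t ∈ Icc 0 T, ‖w t‖ ^ 2 + ‖wt t‖ ^ 2 - (‖w s‖ ^ 2 + ‖wt s‖ ^ 2) =
        2 * ∫ r in s..t, (inner ℝ (h r) (wt r) + inner ℝ (valL2 (u r)) (wt r)) := by
  let P := (WithLp.prodContinuousLinearEquiv 2 ℝ (H10 Ω) (L2 Ω)).symm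
  let ξ : ℝ → EnergySpace Ω := fun t => WithLp.toLp 2 (u t, ut t)
  -- The full H¹ inner product corresponds to Δ - 1, so u is added back to the forcing.
  let k : ℝ → EnergySpace Ω := fun t => WithLp.toLp 2 (0, h t + valL2 (u t))
  have hval : IntegrableOn (fun t => valL2 (u t)) (Ioo 0 T) := (valCLM Ω).integrable_comp hu
  have hgrad : IntegrableOn (fun t => gradL2 (u t)) (Ioo 0 T) := (gradCLM Ω).integrable_comp hu
  have hξ : IntegrableOn ξ (Ioo 0 T) :=
    (P : H10 Ω × L2 Ω →L[ℝ] EnergySpace Ω).integrable_comp (hu.prodMk hut)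
  have hk : IntegrableOn k (Ioo 0 T) :=
    (P : H10 Ω × L2 Ω →L[ℝ] EnergySpace Ω).integrable_comp
      ((integrable_zero ℝ (H10 Ω) _).prodMk (hh.add hval))
  -- Only the second component of a kernel element has to vanish, since `k` has first component 0.
  have hkS : ∀ t n, waveInverse Ω n = 0 → inner ℝ n (k t) = 0 := by
    intro t n hn
    have hb : n.snd = 0 := by
      apply eq_zero_of_adjoint_valCLM hΩ
      have := congrArg WithLp.fst hn
      exact neg_eq_zero.1 this
    rw [WithLp.prod_inner_apply]
    change inner ℝ n.fst 0 + inner ℝ n.snd _ = _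
    rw [hb, inner_zero_right, inner_zero_left, add_zero]
  let D : Set (EnergySpace Ω) := P '' ({v : H10 Ω | ∃ φ : Space → ℝ, IsTestFunction Ω φ ∧
    (valL2 v : Space → ℝ) =ᵐ[volume.restrict Ω] φ ∧
    (gradL2 v : Space → Space) =ᵐ[volume.restrict Ω] gradient φ} ×ˢ (testL2 Ω : Set (L2 Ω)))
  have hD : Dense D := by
    refine DenseRange.dense_image P.surjective.denseRange P.continuous ?_
    exact dense_testFunctions_H10.prod (dense_testFunctions_L2 hΩ)
  have mulInt : ∀ {θ : ℝ → ℝ} {z : ℝ → ℝ}, Continuous θ → HasCompactSupport θ →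
      IntegrableOn z (Ioo 0 T) → IntegrableOn (fun t => θ t * z t) (Ioo 0 T) :=
    fun hθ hθc hz => integrableOn_smul_of_hasCompactSupport hθ hθc hz
  have hweak : ∀ e ∈ D, ∀ θ, IsTestFunction (Ioo 0 T) θ →
      ∫ t in Ioo 0 T, deriv θ t * inner ℝ e (waveInverse Ω (ξ t)) =
        -∫ t in Ioo 0 T, θ t * inner ℝ e (ξ t + waveInverse Ω (k t)) := by
    rintro _ ⟨⟨v, ψ⟩, ⟨⟨φ, hφ, hv1, hv2⟩, hψ⟩, rfl⟩ θ hθ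
    have hθ' : Continuous (deriv θ) := hθ.contDiff.continuous_deriv (by simp)
    have hθ'c := hθ.hasCompactSupport.deriv
    have e1 : ∀ t, inner ℝ (P (v, ψ)) (waveInverse Ω (ξ t)) =
        -inner ℝ (valL2 v) (ut t) + inner ℝ ψ (valL2 (u t)) := fun t => inner_waveInverse _ _
    -- The L² part of the H¹ inner product cancels the u added to the forcing; the gradient pairing
    -- remains.
    have e2 : ∀ t, inner ℝ (P (v, ψ)) (ξ t + waveInverse Ω (k t)) =
        (inner ℝ (gradL2 v) (gradL2 (u t)) - inner ℝ (valL2 v) (h t)) + inner ℝ ψ (ut t) := by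
      intro t
      rw [inner_add_right, inner_waveInverse, WithLp.prod_inner_apply]
      change inner ℝ v (u t) + inner ℝ ψ (ut t) +
        (-inner ℝ (valL2 v) (h t + valL2 (u t)) + inner ℝ ψ (valCLM Ω 0)) = _
      rw [H10_inner, inner_add_right, map_zero, inner_zero_right]
      ring
    have i1 : IntegrableOn (fun t => deriv θ t * inner ℝ (valL2 v) (ut t)) (Ioo 0 T) :=
      mulInt hθ' hθ'c (hut.const_inner _)
    have i2 : IntegrableOn (fun t => deriv θ t * inner ℝ ψ (valL2 (u t))) (Ioo 0 T) :=
      mulInt hθ' hθ'c (hval.const_inner _)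
    have i3 : IntegrableOn (fun t => θ t * (inner ℝ (gradL2 v) (gradL2 (u t)) -
        inner ℝ (valL2 v) (h t))) (Ioo 0 T) :=
      mulInt hθ.contDiff.continuous hθ.hasCompactSupport
        ((hgrad.const_inner _).sub (hh.const_inner _))
    have i4 : IntegrableOn (fun t => θ t * inner ℝ ψ (ut t)) (Ioo 0 T) :=
      mulInt hθ.contDiff.continuous hθ.hasCompactSupport (hut.const_inner _)
    simp only [e1, e2, mul_add, mul_neg]
    rw [integral_add (by exact i1.neg) i2, integral_add i3 i4, integral_neg, h1 ψ hψ θ hθ,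
      h2 v φ hφ hv1 hv2 θ hθ]
    ring
  obtain ⟨W, hW, hWc, hWS, hWE⟩ :=
    exists_continuous_representative inner_waveInverse_self hT hξ hk hkS hD hweak
  have hfst : Continuous (WithLp.fst : EnergySpace Ω → H10 Ω) :=
    (WithLp.fstL 2 ℝ (H10 Ω) (L2 Ω)).continuous
  have hsnd : Continuous (WithLp.snd : EnergySpace Ω → L2 Ω) :=
    (WithLp.sndL 2 ℝ (H10 Ω) (L2 Ω)).continuous
  have hWi : ∀ s ∈ Icc 0 T, ∀ t ∈ Icc 0 T, IntervalIntegrable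
      (fun r => W r + waveInverse Ω (k r)) volume s t := by
    intro s hs t ht
    refine IntervalIntegrable.add (hWc.mono (uIcc_subset_Icc hs ht)).intervalIntegrable ?_
    exact intervalIntegrable_of_subset ((intervalIntegrable_iff_integrableOn_Ioo_of_le hT.le).2
      ((waveInverse Ω).integrable_comp hk)) hT.le hs ht
  refine ⟨fun t => (W t).fst, fun t => (W t).snd, ?_, ?_, hfst.comp_continuousOn hWc,
    hsnd.comp_continuousOn hWc, fun s hs t ht => ?_, fun s hs t ht => ?_⟩
  · filter_upwards [hW] with t ht
    exact congrArg WithLp.fst ht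
  · filter_upwards [hW] with t ht
    exact congrArg WithLp.snd ht
  · have h3 := congrArg (WithLp.sndL 2 ℝ (H10 Ω) (L2 Ω)) (hWS s hs t ht)
    rw [← ContinuousLinearMap.intervalIntegral_comp_comm _ (hWi s hs t ht)] at h3
    have e : ∀ r, (WithLp.sndL 2 ℝ (H10 Ω) (L2 Ω)) (W r + waveInverse Ω (k r)) = (W r).snd := by
      intro r
      change (W r).snd + valCLM Ω 0 = _
      rw [map_zero, add_zero]
    simp only [e] at h3
    exact h3
  · rw [← WithLp.prod_norm_sq_eq_of_L2, ← WithLp.prod_norm_sq_eq_of_L2, hWE s hs t ht]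
    congr 1
    refine intervalIntegral.integral_congr fun r _ => ?_
    change inner ℝ (k r) (W r) = _
    rw [WithLp.prod_inner_apply]
    change inner ℝ 0 (W r).fst + inner ℝ (h r + valL2 (u r)) (W r).snd = _
    rw [inner_zero_left, zero_add, inner_add_left]

end LinearWave

/-! ### From the distributional equation to the linear problem. -/

section WeakFormulation

variable {Ω : Set Space} {T γ : ℝ} {f : ℝ → ℝ} {g : L2 Ω} {u : ℝ → H10 Ω} {ut : ℝ → L2 Ω}

theorem isFiniteMeasure_restrict (hΩ : Bornology.IsBounded Ω) :
    IsFiniteMeasure (volume.restrict Ω) := ⟨by simpa using hΩ.measure_lt_top⟩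

/-- Products θ(t)φ(x) are the only space-time test functions used: they turn the equation into
scalar identities in time. -/
theorem IsTestFunction.tensor {I : Set ℝ} {θ : ℝ → ℝ} {φ : Space → ℝ} (hθ : IsTestFunction I θ)
    (hφ : IsTestFunction Ω φ) :
    IsTestFunction (I ×ˢ Ω) fun p : ℝ × Space => θ p.1 * φ p.2 := by
  have hsupp : tsupport (fun p : ℝ × Space => θ p.1 * φ p.2) ⊆ tsupport θ ×ˢ tsupport φ := by
    refine closure_minimal (fun p hp => ?_)
      ((isClosed_tsupport θ).prod (isClosed_tsupport φ))
    exact ⟨subset_tsupport _ (left_ne_zero_of_mul hp), subset_tsupport _ (right_ne_zero_of_mul hp)⟩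
  refine ⟨(hθ.contDiff.comp contDiff_fst).mul (hφ.contDiff.comp contDiff_snd), ?_,
    hsupp.trans (prod_mono hθ.tsupport_subset hφ.tsupport_subset)⟩
  exact (hθ.hasCompactSupport.isCompact.prod hφ.hasCompactSupport.isCompact).of_isClosed_subset
    (isClosed_tsupport _) hsupp

theorem timeDeriv_tensor {I : Set ℝ} {θ : ℝ → ℝ} {φ : Space → ℝ} (hθ : IsTestFunction I θ)
    (t : ℝ) (x : Space) :
    timeDeriv (fun p : ℝ × Space => θ p.1 * φ p.2) t x = deriv θ t * φ x :=
  deriv_mul_const (hθ.contDiff.differentiable (by simp) t) (φ x)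

theorem spaceGrad_tensor {θ : ℝ → ℝ} {φ : Space → ℝ} (hφ : IsTestFunction Ω φ)
    (t : ℝ) (x : Space) :
    spaceGrad (fun p : ℝ × Space => θ p.1 * φ p.2) t x = θ t • gradient φ x :=
  congrFun (gradient_const_smul_of_contDiff (θ t) hφ.contDiff) x

theorem integral_mul_tensor {v ψ : L2 Ω} {φ : Space → ℝ}
    (hψ : (ψ : Space → ℝ) =ᵐ[volume.restrict Ω] φ) (c : ℝ) :
    ∫ x in Ω, v x * (c * φ x) = c * inner ℝ ψ v := by
  rw [L2_inner_eq_integral hψ (EventuallyEq.refl _ _), ← integral_const_mul]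
  congr 1
  funext x
  ring

theorem IsWeakSolution.weak_time_deriv (hu : IsWeakSolution Ω T γ f g u ut) {ψ : L2 Ω}
    (hψ : ψ ∈ testL2 Ω) {θ : ℝ → ℝ} (hθ : IsTestFunction (Ioo 0 T) θ) :
    ∫ t in Ioo 0 T, deriv θ t * inner ℝ ψ (valL2 (u t)) =
      -∫ t in Ioo 0 T, θ t * inner ℝ ψ (ut t) := by
  obtain ⟨φ, hφ, hψφ⟩ := hψ
  have := hu.time_deriv _ (hθ.tensor hφ)
  simpa only [timeDeriv_tensor hθ, integral_mul_tensor hψφ] using this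

theorem IsWeakSolution.weak_equation (hu : IsWeakSolution Ω T γ f g u ut)
    (hui : IntegrableOn u (Ioo 0 T)) (huti : IntegrableOn ut (Ioo 0 T))
    (hfm : ∀ᵐ t ∂volume.restrict (Ioo 0 T),
      MemLp (fun x => f (valL2 (u t) x)) 2 (volume.restrict Ω))
    (hfi : IntegrableOn (fun t => superposition f (valL2 (u t))) (Ioo 0 T))
    {v : H10 Ω} {φ : Space → ℝ} (hφ : IsTestFunction Ω φ)
    (hv : (valL2 v : Space → ℝ) =ᵐ[volume.restrict Ω] φ)
    (hgv : (gradL2 v : Space → Space) =ᵐ[volume.restrict Ω] gradient φ)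
    {θ : ℝ → ℝ} (hθ : IsTestFunction (Ioo 0 T) θ) :
    ∫ t in Ioo 0 T, deriv θ t * inner ℝ (valL2 v) (ut t) =
      ∫ t in Ioo 0 T, θ t * (inner ℝ (gradL2 v) (gradL2 (u t)) -
        inner ℝ (valL2 v) (g - superposition f (valL2 (u t)) - γ • ut t)) := by
  have h1 := hu.equation _ (hθ.tensor hφ)
  have h2 := hu.weak_time_deriv ⟨φ, hφ, hv⟩ hθ
  have e1 : ∀ t, ∫ x in Ω, inner ℝ (gradL2 (u t) x)
      (spaceGrad (fun p : ℝ × Space => θ p.1 * φ p.2) t x) =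
        θ t * inner ℝ (gradL2 v) (gradL2 (u t)) := by
    intro t
    rw [L2.inner_def, ← integral_const_mul]
    refine integral_congr_ae ?_
    filter_upwards [hgv] with x hx
    rw [spaceGrad_tensor hφ, hx, real_inner_smul_right, real_inner_comm]
  -- The default value 0 of `superposition` matters only on the null set of times excluded by `hfm`.
  have e2 : ∫ t in Ioo 0 T, ∫ x in Ω, f (valL2 (u t) x) * (θ t * φ x) =
      ∫ t in Ioo 0 T, θ t * inner ℝ (valL2 v) (superposition f (valL2 (u t))) := by
    refine integral_congr_ae ?_
    filter_upwards [hfm] with t ht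
    rw [← integral_mul_tensor hv]
    refine integral_congr_ae ?_
    filter_upwards [coeFn_superposition ht] with x hx
    rw [hx]
  simp only [timeDeriv_tensor hθ, integral_mul_tensor hv, e1, e2] at h1
  -- The distributional time derivative turns the damping term into γ∫(∂ₜu, φ)θ.
  rw [h2] at h1
  have mulInt : ∀ {z : ℝ → ℝ}, IntegrableOn z (Ioo 0 T) →
      IntegrableOn (fun t => θ t * z t) (Ioo 0 T) :=
    fun hz => integrableOn_smul_of_hasCompactSupport hθ.contDiff.continuous hθ.hasCompactSupport hz
  have hgrad : IntegrableOn (fun t => gradL2 (u t)) (Ioo 0 T) := (gradCLM Ω).integrable_comp hui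
  have i1 := mulInt (hgrad.const_inner (𝕜 := ℝ) (gradL2 v))
  have i2 : IntegrableOn (fun t => θ t * inner ℝ (valL2 v) g) (Ioo 0 T) :=
    mulInt (z := fun _ => inner ℝ (valL2 v) g) (by simp)
  have i3 := mulInt (hfi.const_inner (𝕜 := ℝ) (valL2 v))
  have i4 := mulInt (huti.const_inner (𝕜 := ℝ) (valL2 v))
  have e3 : ∀ t, θ t * (inner ℝ (gradL2 v) (gradL2 (u t)) -
        inner ℝ (valL2 v) (g - superposition f (valL2 (u t)) - γ • ut t)) =
      θ t * inner ℝ (gradL2 v) (gradL2 (u t)) - θ t * inner ℝ (valL2 v) g +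
        θ t * inner ℝ (valL2 v) (superposition f (valL2 (u t))) +
        γ * (θ t * inner ℝ (valL2 v) (ut t)) := by
    intro t
    rw [inner_sub_right, inner_sub_right, real_inner_smul_right]
    ring
  simp only [e3]
  rw [integral_add (by exact (i1.sub i2).add i3) (i4.const_mul γ),
    integral_add (by exact i1.sub i2) i3, integral_sub i1 i2, integral_const_mul]
  linarith

/-- The bound of the nonlinearity in `L¹(0, T; L²(Ω))`. -/
theorem IsShatahStruweSolution.lintegral_quinticBound_ne_top (hΩ : Bornology.IsBounded Ω)
    (hu : IsShatahStruweSolution Ω T γ f g u ut) :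
    ∫⁻ t in Ioo 0 T, quinticBound (valL2 (u t)) ≠ ⊤ := by
  have := isFiniteMeasure_restrict hΩ
  obtain ⟨C, hC⟩ := exists_sobolev_const Ω
  -- The essential supremum of the H¹ norm bounds the L⁶ factor through Sobolev; only the fourth
  -- power of the L¹² norm is left to integrate.
  set M := eLpNorm u ⊤ (volume.restrict (Ioo 0 T)) with hM
  have hM' : M ≠ ⊤ := hu.memLp_u.eLpNorm_ne_top
  have hbound : ∀ᵐ t ∂volume.restrict (Ioo 0 T), quinticBound (valL2 (u t)) ≤
      volume.restrict Ω univ ^ (1 / 2 : ℝ) +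
        C * M * eLpNorm (valL2 (u t)) 12 (volume.restrict Ω) ^ 4 := by
    have h1 : ∀ᵐ t ∂volume.restrict (Ioo 0 T), ‖u t‖ₑ ≤ M := by
      rw [hM, eLpNorm_exponent_top]
      exact enorm_ae_le_eLpNormEssSup u _
    filter_upwards [h1] with t ht
    rw [quinticBound]
    gcongr
    refine (hC (u t)).trans ?_
    gcongr
    refine le_trans ?_ ht
    rw [enorm_le_iff_norm_le]
    refine le_of_sq_le_sq ?_ (norm_nonneg _)
    rw [H10_norm_sq]
    exact le_add_of_nonneg_left (sq_nonneg _)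
  refine ne_top_of_le_ne_top ?_ (lintegral_mono_ae hbound)
  rw [lintegral_add_left measurable_const, lintegral_const_mul' _ _
    (ENNReal.mul_ne_top ENNReal.coe_ne_top hM'), lintegral_const]
  refine ENNReal.add_ne_top.2 ⟨ENNReal.mul_ne_top
    (ENNReal.rpow_ne_top_of_nonneg (by norm_num) (measure_ne_top _ _)) (by simp),
    ENNReal.mul_ne_top (ENNReal.mul_ne_top ENNReal.coe_ne_top hM') hu.strichartz.ne⟩

theorem aestronglyMeasurable_valL2 {ν : Measure ℝ} (hu : AEStronglyMeasurable u ν) :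
    AEStronglyMeasurable (fun t => valL2 (u t)) ν :=
  (valCLM Ω).continuous.comp_aestronglyMeasurable hu

/-- The nonlinearity along a function with an integrable bound is in `L¹(0, T; L²(Ω))`. -/
theorem integrableOn_superposition [IsFiniteMeasure (volume.restrict Ω)] {v : ℝ → L2 Ω}
    (hv : AEStronglyMeasurable v (volume.restrict (Ioo 0 T)))
    (hb : ∫⁻ t in Ioo 0 T, quinticBound (v t) ≠ ⊤) {fn : ℕ → ℝ → ℝ}
    (hf : Continuous f) {A : ℝ} (hA0 : 0 ≤ A) (hA : ∀ s, |f s| ≤ A * (1 + |s| ^ 5))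
    (hL : ∀ n, ∃ L : NNReal, LipschitzWith L (fn n))
    (hAn : ∀ n s, |fn n s| ≤ A * (1 + |s| ^ 5))
    (heq : ∀ (n : ℕ) (s : ℝ), |s| ≤ n → fn n s = f s) :
    IntegrableOn (fun t => superposition f (v t)) (Ioo 0 T) := by
  have hm := aemeasurable_quinticBound hv
  have hfin : ∀ᵐ t ∂volume.restrict (Ioo 0 T), quinticBound (v t) ≠ ⊤ :=
    (ae_lt_top' hm hb).mono fun t ht => ht.ne
  have hfn : ∀ n, Continuous (fn n) := fun n => (hL n).choose_spec.continuous
  have hmeas : AEStronglyMeasurable (fun t => superposition f (v t))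
      (volume.restrict (Ioo 0 T)) := by
    refine aestronglyMeasurable_of_tendsto_ae atTop
      (f := fun n t => superposition (fn n) (v t)) (fun n => ?_) ?_
    · exact (continuous_superposition (hL n).choose_spec).comp_aestronglyMeasurable hv
    · filter_upwards [hfin] with t ht
      exact tendsto_superposition hf hfn hA hAn heq ht
  refine ((integrable_toReal_of_lintegral_ne_top hm hb).const_mul A).mono' hmeas ?_
  filter_upwards [hfin] with t ht
  exact norm_superposition_le hf hA0 hA ht

end WeakFormulation

section PotentialEnergy

/-- The fundamental theorem of calculus between arbitrary points of an interval. -/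
theorem sub_eq_integral_of_hasDerivAt {E : Type*} [NormedAddCommGroup E] [NormedSpace ℝ E]
    [CompleteSpace E] {a b : ℝ} {F F' : ℝ → E} (hF : ContinuousOn F (Icc a b))
    (hF' : ContinuousOn F' (Icc a b)) (hd : ∀ t ∈ Ioo a b, HasDerivAt F (F' t) t) {s t : ℝ}
    (hs : s ∈ Icc a b) (ht : t ∈ Icc a b) : F t - F s = ∫ r in s..t, F' r := by
  have key : ∀ s ∈ Icc a b, ∀ t ∈ Icc a b, s ≤ t → ∫ r in s..t, F' r = F t - F s := by
    intro s hs t ht hst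
    refine intervalIntegral.integral_eq_sub_of_hasDerivAt_of_le hst
      (hF.mono (Icc_subset_Icc hs.1 ht.2))
      (fun x hx => hd x ⟨hs.1.trans_lt hx.1, hx.2.trans_le ht.2⟩)
      (hF'.mono (uIcc_subset_Icc hs ht)).intervalIntegrable
  rcases le_total s t with hst | hst
  · exact (key s hs t ht hst).symm
  · rw [intervalIntegral.integral_symm, key t ht s hs hst, neg_sub]

theorem hasDerivAt_of_sub_eq_integral {E : Type*} [NormedAddCommGroup E] [NormedSpace ℝ E]
    [CompleteSpace E] {a b : ℝ} {F F' : ℝ → E} (hF' : ContinuousOn F' (Icc a b))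
    (h : ∀ s ∈ Icc a b, ∀ t ∈ Icc a b, F t - F s = ∫ r in s..t, F' r) {t : ℝ} (ht : t ∈ Ioo a b) :
    HasDerivAt F (F' t) t := by
  have ha : a ∈ Icc a b := left_mem_Icc.2 (ht.1.trans ht.2).le
  have ht' := Ioo_subset_Icc_self ht
  have h1 : HasDerivAt (fun t => F a + ∫ r in a..t, F' r) (F' t) t :=
    (intervalIntegral.integral_hasDerivAt_right
      (hF'.mono (uIcc_subset_Icc ha ht')).intervalIntegrable
      ((hF'.mono Ioo_subset_Icc_self).stronglyMeasurableAtFilter isOpen_Ioo t ht)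
      (hF'.continuousAt (Icc_mem_nhds ht.1 ht.2))).const_add _
  refine h1.congr_of_eventuallyEq ?_
  filter_upwards [Ioo_mem_nhds ht.1 ht.2] with r hr
  rw [← h a ha r (Ioo_subset_Icc_self hr), add_sub_cancel]

variable {Ω : Set Space} {T : ℝ}

theorem integrable_primitive [IsFiniteMeasure (volume.restrict Ω)] {f : ℝ → ℝ}
    (hf : Continuous f) {A : ℝ} (hA0 : 0 ≤ A) (hA : ∀ s, |f s| ≤ A * (1 + |s| ^ 5)) (v : H10 Ω) :
    Integrable (fun x => 1 + |valL2 v x| ^ 6) (volume.restrict Ω) ∧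
      IntegrableOn (fun x => primitive f (valL2 v x)) Ω := by
  obtain ⟨C, hC⟩ := exists_sobolev_const Ω
  have h6 : MemLp (valL2 v) 6 (volume.restrict Ω) := ⟨Lp.aestronglyMeasurable _,
    (hC v).trans_lt (ENNReal.mul_lt_top ENNReal.coe_lt_top enorm_lt_top)⟩
  have h1 : Integrable (fun x => 1 + |valL2 v x| ^ 6) (volume.restrict Ω) :=
    (integrable_const _).add (by simpa using h6.integrable_norm_pow (p := 6) (by norm_num))
  refine ⟨h1, (h1.const_mul (A * 2)).mono'
    ((continuous_primitive hf).comp_aestronglyMeasurable (Lp.aestronglyMeasurable _))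
    (Eventually.of_forall fun x => abs_primitive_le hA0 hA _)⟩

/-- The chain rule for the potential energy. -/
theorem potentialEnergy_sub_eq_integral [IsFiniteMeasure (volume.restrict Ω)]
    {w : ℝ → H10 Ω} {wt : ℝ → L2 Ω} (hT : 0 < T)
    (hw : ContinuousOn w (Icc 0 T)) (hwt : ContinuousOn wt (Icc 0 T))
    (hd : ∀ t ∈ Ioo 0 T, HasDerivAt (fun t => valL2 (w t)) (wt t) t)
    (hb : ∫⁻ t in Ioo 0 T, quinticBound (valL2 (w t)) ≠ ⊤) {f : ℝ → ℝ} {fn : ℕ → ℝ → ℝ}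
    (hf : Continuous f) {A : ℝ} (hA0 : 0 ≤ A) (hA : ∀ s, |f s| ≤ A * (1 + |s| ^ 5))
    (hL : ∀ n, ∃ L : NNReal, LipschitzWith L (fn n))
    (hAn : ∀ n s, |fn n s| ≤ A * (1 + |s| ^ 5))
    (heq : ∀ (n : ℕ) (s : ℝ), |s| ≤ n → fn n s = f s) {s t : ℝ} (hs : s ∈ Icc 0 T)
    (ht : t ∈ Icc 0 T) :
    potentialEnergy f (w t) - potentialEnergy f (w s) =
      ∫ r in s..t, inner ℝ (superposition f (valL2 (w r))) (wt r) := by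
  have hfn : ∀ n, Continuous (fn n) := fun n => (hL n).choose_spec.continuous
  have hval : ContinuousOn (fun t => valL2 (w t)) (Icc 0 T) :=
    (valCLM Ω).continuous.comp_continuousOn hw
  have hsup : ∀ n, ContinuousOn (fun t => superposition (fn n) (valL2 (w t))) (Icc 0 T) := fun n =>
    (continuous_superposition (hL n).choose_spec).comp_continuousOn hval
  have hn : ∀ n, potentialEnergy (fn n) (w t) - potentialEnergy (fn n) (w s) =
      ∫ r in s..t, inner ℝ (superposition (fn n) (valL2 (w r))) (wt r) := by
    intro n
    have hdiff := fun v => hasFDerivAt_integral_primitive (μ := volume.restrict Ω)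
      (hL n).choose_spec v
    refine sub_eq_integral_of_hasDerivAt (a := 0) (b := T)
      (F := fun t => potentialEnergy (fn n) (w t)) ?_ ((hsup n).inner hwt) (fun r hr => ?_) hs ht
    · have hc : Continuous fun v : L2 Ω => ∫ x in Ω, primitive (fn n) (v x) :=
        continuous_iff_continuousAt.2 fun v => (hdiff v).continuousAt
      exact hc.comp_continuousOn hval
    · exact (hdiff (valL2 (w r))).comp_hasDerivAt r (hd r hr)
  have hpot : ∀ r, Tendsto (fun n => potentialEnergy (fn n) (w r)) atTop
      (𝓝 (potentialEnergy f (w r))) := by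
    intro r
    refine tendsto_integral_of_dominated_convergence
      (fun x => A * 2 * (1 + |valL2 (w r) x| ^ 6))
      (fun n => (continuous_primitive (hfn n)).comp_aestronglyMeasurable (Lp.aestronglyMeasurable _))
      ((integrable_primitive hf hA0 hA (w r)).1.const_mul _)
      (fun n => Eventually.of_forall fun x => abs_primitive_le hA0 (hAn n) _)
      (Eventually.of_forall fun x => ?_)
    obtain ⟨n₀, hn₀⟩ := exists_nat_ge |valL2 (w r) x|
    refine tendsto_const_nhds.congr' ?_
    filter_upwards [eventually_ge_atTop n₀] with n hn
    refine intervalIntegral.integral_congr fun y hy => ?_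
    refine (heq n y ?_).symm
    have h1 := abs_sub_left_of_mem_uIcc hy
    rw [sub_zero, sub_zero] at h1
    exact h1.trans (hn₀.trans (by exact_mod_cast hn))
  obtain ⟨B, hB⟩ := isCompact_Icc.exists_bound_of_continuousOn hwt
  have hm : AEMeasurable (fun t => quinticBound (valL2 (w t))) (volume.restrict (Ioo 0 T)) :=
    aemeasurable_quinticBound
      ((hval.mono Ioo_subset_Icc_self).aestronglyMeasurable measurableSet_Ioo)
  have hfin : ∀ᵐ r, r ∈ uIoc s t → quinticBound (valL2 (w r)) ≠ ⊤ := by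
    have h1 : ∀ᵐ x : ℝ, x ≠ T := by simp [ae_iff, measure_singleton]
    filter_upwards [(ae_restrict_iff' measurableSet_Ioo).1 (ae_lt_top' hm hb), h1] with r hr hrT hrs
    have h2 : r ∈ Ioc 0 T := Ioc_subset_Ioc (le_min hs.1 ht.1) (max_le hs.2 ht.2) hrs
    exact (hr ⟨h2.1, lt_of_le_of_ne h2.2 hrT⟩).ne
  have hbi : IntervalIntegrable (fun r => (quinticBound (valL2 (w r))).toReal) volume s t :=
    intervalIntegrable_of_subset ((intervalIntegrable_iff_integrableOn_Ioo_of_le hT.le).2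
      (integrable_toReal_of_lintegral_ne_top hm hb)) hT.le hs ht
  have hsub : uIoc s t ⊆ Icc 0 T := uIoc_subset_uIcc.trans (uIcc_subset_Icc hs ht)
  refine tendsto_nhds_unique (((hpot t).sub (hpot s)).congr hn) ?_
  refine intervalIntegral.tendsto_integral_filter_of_dominated_convergence
    (fun r => A * (quinticBound (valL2 (w r))).toReal * B) (Eventually.of_forall fun n => ?_)
    (Eventually.of_forall fun n => ?_) ((hbi.const_mul A).mul_const B) ?_
  · exact (((hsup n).inner hwt).mono hsub).aestronglyMeasurable measurableSet_uIoc
  · filter_upwards [hfin] with r hr hrs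
    refine (norm_inner_le_norm _ _).trans ?_
    exact mul_le_mul (norm_superposition_le (hfn n) hA0 (hAn n) (hr hrs)) (hB r (hsub hrs))
      (norm_nonneg _) (by positivity)
  · filter_upwards [hfin] with r hr hrs
    exact (tendsto_superposition hf hfn hA hAn heq (hr hrs)).inner tendsto_const_nhds

end PotentialEnergy

section EnergyNorm

variable {Ω : Set Space}

theorem energyNorm_nonneg (v : H10 Ω) (y : L2 Ω) : 0 ≤ energyNorm v y := Real.sqrt_nonneg _

theorem energyNorm_sq (v : H10 Ω) (y : L2 Ω) : energyNorm v y ^ 2 = ‖gradL2 v‖ ^ 2 + ‖y‖ ^ 2 :=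
  Real.sq_sqrt (by positivity)

theorem norm_le_energyNorm (v : H10 Ω) (y : L2 Ω) : ‖y‖ ≤ energyNorm v y :=
  Real.le_sqrt_of_sq_le (le_add_of_nonneg_left (sq_nonneg _))

/-- The energy norm of a solution of the linear wave equation with an `L¹(0, T; L²(Ω))` right-hand
side is absolutely continuous. -/
theorem absolutelyContinuousOnInterval_energyNorm {T : ℝ} (hT : 0 ≤ T) {w : ℝ → H10 Ω}
    {wt h : ℝ → L2 Ω} (hw : ContinuousOn w (Icc 0 T)) (hwt : ContinuousOn wt (Icc 0 T))
    (hh : IntegrableOn h (Ioo 0 T))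
    (he : ∀ s ∈ Icc 0 T, ∀ t ∈ Icc 0 T, energyNorm (w t) (wt t) ^ 2 - energyNorm (w s) (wt s) ^ 2 =
      2 * ∫ r in s..t, inner ℝ (h r) (wt r)) :
    AbsolutelyContinuousOnInterval (fun t => energyNorm (w t) (wt t)) 0 T := by
  have hh' : IntervalIntegrable h volume 0 T :=
    (intervalIntegrable_iff_integrableOn_Ioo_of_le hT).2 hh
  have hcont : ContinuousOn (fun t => energyNorm (w t) (wt t)) (Icc 0 T) :=
    ((((gradCLM Ω).continuous.comp_continuousOn hw).norm.pow 2).add (hwt.norm.pow 2)).sqrt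
  refine absolutelyContinuousOnInterval_of_dist_le_integral hT (hh'.norm.const_mul 2)
    fun s hs t ht hst => ?_
  have hsub : Icc s t ⊆ Icc 0 T := Icc_subset_Icc hs.1 ht.2
  have key : ∀ a ∈ Icc s t, ∀ b ∈ Icc s t, energyNorm (w b) (wt b) ≤ energyNorm (w a) (wt a) +
      2 * ∫ r in s..t, ‖h r‖ := by
    intro a ha b hb
    refine le_add_two_mul_integral (e := fun t => energyNorm (w t) (wt t))
      (κ := fun t => ‖h t‖) hst (hcont.mono hsub) (fun _ => energyNorm_nonneg _ _)
      (fun _ => norm_nonneg _) (intervalIntegrable_of_subset hh' hT hs ht).norm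
      (fun a ha b hb => ?_) ha hb
    have hi : IntervalIntegrable (fun r => ‖h r‖ * energyNorm (w r) (wt r)) volume a b :=
      (intervalIntegrable_of_subset hh' hT (hsub ha) (hsub hb)).norm.mul_continuousOn
        (hcont.mono (uIcc_subset_Icc (hsub ha) (hsub hb)))
    have h1 : |∫ r in a..b, inner ℝ (h r) (wt r)| ≤
        |∫ r in a..b, ‖h r‖ * energyNorm (w r) (wt r)| :=
      intervalIntegral.norm_integral_le_abs_of_norm_le
        (Eventually.of_forall fun r => (norm_inner_le_norm (𝕜 := ℝ) (h r) (wt r)).trans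
          (mul_le_mul_of_nonneg_left (norm_le_energyNorm _ _) (norm_nonneg _))) hi
    rw [abs_mul, abs_two]
    linarith [he a (hsub ha) b (hsub hb), le_abs_self (∫ r in a..b, inner ℝ (h r) (wt r))]
  rw [intervalIntegral.integral_const_mul, Real.dist_eq, abs_sub_le_iff]
  constructor
  · linarith [key t (right_mem_Icc.2 hst) s (left_mem_Icc.2 hst)]
  · linarith [key s (left_mem_Icc.2 hst) t (right_mem_Icc.2 hst)]

end EnergyNorm

end DampedWave

end

open DampedWave in
theorem mainTheorem11 (Ω : Set Space) (hΩ : IsSmoothBoundedDomain Ω)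
    (γ : ℝ) (hγ : 0 < γ) (T : ℝ) (hT : 0 < T)
    (f : ℝ → ℝ) (hf : ContDiff ℝ 1 f)
    (hgrowth : ∃ C : ℝ, ∀ s : ℝ, |deriv f s| ≤ C * (1 + |s| ^ 4))
    (g : L2 Ω) (u : ℝ → H10 Ω) (ut : ℝ → L2 Ω)
    (hu : IsShatahStruweSolution Ω T γ f g u ut) :
    ∃ (w : ℝ → H10 Ω) (wt : ℝ → L2 Ω),
      w =ᵐ[volume.restrict (Ioo 0 T)] u ∧
      wt =ᵐ[volume.restrict (Ioo 0 T)] ut ∧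
      ContinuousOn (fun t => (w t, wt t)) (Icc 0 T) ∧
      AbsolutelyContinuousOnInterval (fun t => energyNorm (w t) (wt t)) 0 T ∧
      (∀ t ∈ Icc 0 T, IntegrableOn (fun x => primitive f (valL2 (w t) x)) Ω) ∧
      AbsolutelyContinuousOnInterval (fun t => potentialEnergy f (w t)) 0 T ∧
      ∀ᵐ t ∂(volume.restrict (Icc 0 T)),
        HasDerivAt (fun s => 1 / 2 * energyNorm (w s) (wt s) ^ 2 + potentialEnergy f (w s)
            - inner ℝ g (valL2 (w s)))
          (-(γ * ‖wt t‖ ^ 2)) t := by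
  have := isFiniteMeasure_restrict hΩ.isBounded
  obtain ⟨A, hA0, hA, fn, hL, hAn, heq⟩ := exists_truncation hf hgrowth
  have hui : IntegrableOn u (Ioo 0 T) := hu.memLp_u.integrable le_top
  have huti : IntegrableOn ut (Ioo 0 T) := hu.memLp_ut.integrable le_top
  have hvm := aestronglyMeasurable_valL2 hui.aestronglyMeasurable
  have hb := hu.lintegral_quinticBound_ne_top hΩ.isBounded
  have hfi := integrableOn_superposition hvm hb hf.continuous hA0 hA hL hAn heq
  have hfm : ∀ᵐ t ∂volume.restrict (Ioo 0 T),
      MemLp (fun x => f (valL2 (u t) x)) 2 (volume.restrict Ω) :=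
    (ae_lt_top' (aemeasurable_quinticBound hvm) hb).mono fun t ht =>
      memLp_comp_of_quintic hf.continuous hA ht.ne
  have hgi : IntegrableOn (fun _ : ℝ => g) (Ioo 0 T) := by simp
  have hvi : IntegrableOn (fun t => valL2 (u t)) (Ioo 0 T) := (valCLM Ω).integrable_comp hui
  have hh : IntegrableOn (fun t => g - superposition f (valL2 (u t)) - γ • ut t) (Ioo 0 T) :=
    (hgi.sub hfi).sub (huti.fun_smul γ)
  obtain ⟨w, wt, hwu, hwtut, hw, hwt, hval, hen⟩ := linear_wave hΩ.isOpen hT hui huti hh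
    (fun ψ hψ θ hθ => hu.weak_time_deriv hψ hθ)
    (fun v φ hφ hv hgv θ hθ => hu.weak_equation hui huti hfm hfi hφ hv hgv hθ)
  have hd : ∀ t ∈ Ioo 0 T, HasDerivAt (fun t => valL2 (w t)) (wt t) t := fun t ht =>
    hasDerivAt_of_sub_eq_integral hwt hval ht
  have hvalc : ContinuousOn (fun t => valL2 (w t)) (Icc 0 T) :=
    (valCLM Ω).continuous.comp_continuousOn hw
  -- integrals over subintervals only see the values almost everywhere
  have hcongr : ∀ {F G : ℝ → ℝ}, F =ᵐ[volume.restrict (Ioo 0 T)] G → ∀ s ∈ Icc 0 T,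
      ∀ t ∈ Icc 0 T, ∫ r in s..t, F r = ∫ r in s..t, G r := by
    intro F G hFG s hs t ht
    refine intervalIntegral.integral_congr_ae ?_
    have h1 : ∀ᵐ x : ℝ, x ≠ T := by simp [ae_iff, measure_singleton]
    filter_upwards [(ae_restrict_iff' measurableSet_Ioo).1 hFG, h1] with r hr hrT hrs
    have h2 : r ∈ Ioc 0 T := Ioc_subset_Ioc (le_min hs.1 ht.1) (max_le hs.2 ht.2) hrs
    exact hr ⟨h2.1, lt_of_le_of_ne h2.2 hrT⟩
  have hint : ∀ {h : ℝ → L2 Ω}, IntegrableOn h (Ioo 0 T) → ∀ s ∈ Icc 0 T, ∀ t ∈ Icc 0 T,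
      IntervalIntegrable (fun r => inner ℝ (h r) (wt r)) volume s t := by
    intro h hh s hs t ht
    have h1 := intervalIntegrable_of_subset
      ((intervalIntegrable_iff_integrableOn_Ioo_of_le hT.le).2 hh) hT.le hs ht
    have h2 := hwt.mono (uIcc_subset_Icc hs ht)
    refine (h1.norm.mul_continuousOn h2.norm).mono_fun (h1.def'.aestronglyMeasurable.inner
      ((h2.mono uIoc_subset_uIcc).aestronglyMeasurable measurableSet_uIoc))
      (Eventually.of_forall fun r => ?_)
    simp only [norm_mul, norm_norm]
    exact norm_inner_le_norm _ _
  have hsq : ∀ s ∈ Icc 0 T, ∀ t ∈ Icc 0 T, ‖valL2 (w t)‖ ^ 2 - ‖valL2 (w s)‖ ^ 2 =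
      ∫ r in s..t, 2 * inner ℝ (valL2 (w r)) (wt r) := fun s hs t ht =>
    sub_eq_integral_of_hasDerivAt (F := fun t => ‖valL2 (w t)‖ ^ 2) (hvalc.norm.pow 2)
      ((hvalc.inner hwt).const_mul 2) (fun r hr => (hd r hr).norm_sq) hs ht
  have hE : ∀ s ∈ Icc 0 T, ∀ t ∈ Icc 0 T,
      energyNorm (w t) (wt t) ^ 2 - energyNorm (w s) (wt s) ^ 2 =
        2 * ∫ r in s..t, inner ℝ (g - superposition f (valL2 (u r)) - γ • ut r) (wt r) := by
    intro s hs t ht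
    have h1 := hen s hs t ht
    have h2 := hsq s hs t ht
    rw [intervalIntegral.integral_const_mul] at h2
    have h3 : ∫ r in s..t, inner ℝ (valL2 (u r)) (wt r) =
        ∫ r in s..t, inner ℝ (valL2 (w r)) (wt r) := by
      refine hcongr ?_ s hs t ht
      filter_upwards [hwu] with r hr
      rw [hr]
    rw [intervalIntegral.integral_add (hint hh s hs t ht)
      (hint hvi s hs t ht), h3, H10_norm_sq, H10_norm_sq] at h1
    rw [energyNorm_sq, energyNorm_sq]
    linarith
  have hbw : ∫⁻ t in Ioo 0 T, quinticBound (valL2 (w t)) ≠ ⊤ := by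
    rwa [lintegral_congr_ae (g := fun t => quinticBound (valL2 (u t)))]
    filter_upwards [hwu] with r hr
    rw [hr]
  have hP : ∀ s ∈ Icc 0 T, ∀ t ∈ Icc 0 T, potentialEnergy f (w t) - potentialEnergy f (w s) =
      ∫ r in s..t, inner ℝ (superposition f (valL2 (u r))) (wt r) := by
    intro s hs t ht
    rw [potentialEnergy_sub_eq_integral hT hw hwt hd hbw hf.continuous hA0 hA hL hAn heq hs ht]
    refine hcongr ?_ s hs t ht
    filter_upwards [hwu] with r hr
    rw [hr]
  have hG : ∀ s ∈ Icc 0 T, ∀ t ∈ Icc 0 T, inner ℝ g (valL2 (w t)) - inner ℝ g (valL2 (w s)) =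
      ∫ r in s..t, inner ℝ g (wt r) := by
    intro s hs t ht
    refine sub_eq_integral_of_hasDerivAt (F := fun t => inner ℝ g (valL2 (w t)))
      (continuousOn_const.inner hvalc) (continuousOn_const.inner hwt) (fun r hr => ?_) hs ht
    simpa using (hasDerivAt_const r g).inner ℝ (hd r hr)
  refine ⟨w, wt, hwu, hwtut, hw.prodMk hwt,
    absolutelyContinuousOnInterval_energyNorm hT.le hw hwt hh hE,
    fun t _ => (integrable_primitive hf.continuous hA0 hA (w t)).2, ?_, ?_⟩
  · refine absolutelyContinuousOnInterval_of_dist_le_integral hT.le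
      (hint hfi 0 (left_mem_Icc.2 hT.le) T (right_mem_Icc.2 hT.le)).norm fun s hs t ht hst => ?_
    rw [dist_comm, Real.dist_eq, hP s hs t ht, ← Real.norm_eq_abs]
    exact intervalIntegral.norm_integral_le_integral_norm hst
  · rw [← restrict_Ioo_eq_restrict_Icc]
    filter_upwards [ae_restrict_mem measurableSet_Ioo] with t ht
    have hdc : ContinuousOn (fun t => -(γ * ‖wt t‖ ^ 2)) (Icc 0 T) :=
      ((hwt.norm.pow 2).const_mul γ).neg
    refine hasDerivAt_of_sub_eq_integral hdc (fun s hs t ht => ?_) ht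
    have h1 := hE s hs t ht
    have h2 := hP s hs t ht
    have h3 := hG s hs t ht
    have h4 : ∫ r in s..t, inner ℝ (g - superposition f (valL2 (u r)) - γ • ut r) (wt r) =
        (∫ r in s..t, inner ℝ g (wt r)) -
          (∫ r in s..t, inner ℝ (superposition f (valL2 (u r))) (wt r)) +
          ∫ r in s..t, -(γ * ‖wt r‖ ^ 2) := by
      rw [← intervalIntegral.integral_sub (hint hgi s hs t ht) (hint hfi s hs t ht),
        ← intervalIntegral.integral_add ((hint hgi s hs t ht).sub (hint hfi s hs t ht))
        (hdc.mono (uIcc_subset_Icc hs ht)).intervalIntegrable]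
      refine hcongr ?_ s hs t ht
      filter_upwards [hwtut] with r hr
      rw [inner_sub_left, inner_sub_left, real_inner_smul_left, ← hr, real_inner_self_eq_norm_sq,
        sub_eq_add_neg (_ - _)]
    rw [h4] at h1
    linarith
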